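/- Let $d,n\ge 1$. Let $\sigma_1,\dots,\sigma_d$ be Hermitian $n\times n$ matrices that are elliptic: there is $c>0$ with $\|(\sum_j p_j\sigma_j)v\|\ge c\|p\|\|v\|$ for all $p\in\mathbb R^d$, $v\in\mathbb C^n$. Let $D_0=\sum_j\sigma_j(-\mathrm i\partial_{x_j})$ in $L^2(\mathbb R^d,\mathbb C^n)$, with domain $H^1(\mathbb R^d,\mathbb C^n)$. Let $S\in W^{1,\infty}$ and $V_0\in L^\infty$ be $\mathbb Z^d$-periodic functions on $\mathbb R^d$ with values in the Hermitian $n\times n$ matrices, with $S_-I_n\le S(x)\le S_+I_n$ for almost every $x$, for some constants $S_\pm>0$. Let $H_0=SD_0S+V_0$ (with domain $\{\psi: S\psi\in H^1\}=H^1$), and suppose that $B_-<B_+$ are real numbers such that the interval $(B_-,B_+)$ contains no point of the spectrum of $H_0$. For $E_0\in(B_-,B_+)$ write $R_0=R_0(E_0)=(H_0-E_0)^{-1}$. Let $u\in L^\infty(\mathbb R^d)$ have values in the non-negative Hermitian $n\times n$ matrices, be continuous almost everywhere, and have support in $[-2,2]^d$. Let $0<R<\frac12$. Given points $\xi_i\in\mathbb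 R^d$ with $|\xi_i|_\infty\le R$ for $i\in\mathbb Z^d$, where $|\cdot|_\infty$ is the sup norm, let $u_i$ denote the operator of multiplication by $u(\cdot-i-\xi_i)$ on $L^2(\mathbb R^d,\mathbb C^n)$. For $x\in\mathbb Z^d$ and an even integer $L\ge 0$ let $\Lambda=\{y\in\mathbb R^d:|y-x|_\infty<L/2\}$ and $\tilde\Lambda=\Lambda\cap\mathbb Z^d$, and let $|\Lambda|$ be the Lebesgue measure of $\Lambda$. Let $I$ be a compact subset of $(B_-,B_+)$ and let $q$ be an even integer with $q>2d$. For a $q$-tuple $\{i\}=(i_1,\dots,i_q)\in\tilde\Lambda^q$ put $$K_{\{i\}}=u_{i_1}R_0\,u_{i_2}R_0\cdots u_{i_{q-1}}R_0^2\,u_{i_q}.$$ Then there is a constant $C>0$, independent of $E_0$, of $x$ and $L$, and of the points $\xi_i$, such that for all $E_0\in I$, all $x\in\mathbb Z^d$, all even $L$ and all $(\xi_i)_{i\in\mathbb Z^d}$ as above, $$\sum_{i_1,\dots,i_q\in\tilde\Lambda}\|K_{\{i\}}\|_1\le C|\Lambda|,$$ where $\|\cdot\|_1$ is the trace norm; in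 particular every $K_{\{i\}}$ is trace class. -/

import Mathlib

open MeasureTheory
open scoped ENNReal NNReal ContDiff Matrix.Norms.L2Operator SchwartzMap LineDeriv ComplexOrder

noncomputable section

namespace GappedDirac

/-! ### Abstract Hilbert space notions -/

section Hilbert

variable {H : Type*} [NormedAddCommGroup H] [InnerProductSpace ℂ H]

/-- `R` is the bounded inverse of the (unbounded) operator `T - z`:
`R f = g` if and only if `g` lies in the domain of `T` and `(T - z) g = f`. -/
def IsResolventAt (T : H →ₗ.[ℂ] H) (z : ℂ) (R : H →L[ℂ] H) : Prop :=
  ∀ f g : H, R f = g ↔ ∃ hg : g ∈ T.domain, T ⟨g, hg⟩ - z • g = f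

/-- The resolvent set of an unbounded operator. -/
def unboundedResolventSet (T : H →ₗ.[ℂ] H) : Set ℂ := {z | ∃ R, IsResolventAt T z R}

/-- The spectrum of an unbounded operator. -/
def unboundedSpectrum (T : H →ₗ.[ℂ] H) : Set ℂ := (unboundedResolventSet T)ᶜ

open Classical in
/-- The resolvent `(T - z)⁻¹` for `z` in the resolvent set (and `0` elsewhere). -/
def unboundedResolvent (T : H →ₗ.[ℂ] H) (z : ℂ) : H →L[ℂ] H :=
  if hz : z ∈ unboundedResolventSet T then hz.choose else 0

theorem isResolventAt_unboundedResolvent {T : H →ₗ.[ℂ] H} {z : ℂ}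
    (hz : z ∈ unboundedResolventSet T) :
    IsResolventAt T z (unboundedResolvent T z) := by
  rw [unboundedResolvent, dif_pos hz]
  exact hz.choose_spec

theorem ofReal_inner_mul_self {κ : Type*} (e : HilbertBasis κ ℂ H) {Q : H →L[ℂ] H}
    (hQ : ∀ x y : H, inner ℂ (Q x) y = inner ℂ x (Q y)) (v : H) :
    ENNReal.ofReal (inner ℂ v ((Q * Q) v)).re = ∑' k, ‖inner ℂ (Q v) (e k)‖ₑ ^ 2 := by
  have h : HasSum (fun k => ‖inner ℂ (Q v) (e k)‖ ^ 2) (inner ℂ (Q v) (Q v)).re := by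
    convert! Complex.hasSum_re (e.hasSum_inner_mul_inner (Q v) (Q v)) using 2 with k
    rw [← inner_conj_symm (e k) (Q v), Complex.mul_conj, Complex.normSq_eq_norm_sq,
      Complex.ofReal_re]
  change ENNReal.ofReal (inner ℂ v (Q (Q v))).re = _
  rw [← hQ, ← h.tsum_eq, ENNReal.ofReal_tsum_of_nonneg (fun _ => by positivity) h.summable]
  congr 1 with k
  rw [ENNReal.ofReal_pow (norm_nonneg _), ofReal_norm]

variable [CompleteSpace H]

/-- The trace norm `‖T‖₁ = tr |T|`, where `|T| = (T* T)^(1/2)`, as an element of `[0, ∞]`.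
It is finite exactly when `T` is trace class. The trace is computed in some orthonormal
(Hilbert) basis; it does not depend on that basis, see `traceNorm_eq`. -/
def traceNorm (T : H →L[ℂ] H) : ℝ≥0∞ :=
  ∑' e : (exists_hilbertBasis ℂ H).choose,
    ENNReal.ofReal (inner ℂ (e : H) (CFC.abs T (e : H))).re

theorem traceNorm_eq {ι : Type*} (b : HilbertBasis ι ℂ H) (T : H →L[ℂ] H) :
    traceNorm T = ∑' k, ENNReal.ofReal (inner ℂ (b k) (CFC.abs T (b k))).re := by
  obtain ⟨c, hc⟩ := (exists_hilbertBasis ℂ H).choose_spec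
  obtain ⟨Q, hQs, hQ⟩ : ∃ Q : H →L[ℂ] H, IsSelfAdjoint Q ∧ Q * Q = CFC.abs T :=
    ⟨CFC.sqrt (CFC.abs T), (CFC.sqrt_nonneg _).isSelfAdjoint,
      CFC.sqrt_mul_sqrt_self _ (CFC.abs_nonneg T)⟩
  have hQ' : ∀ x y : H, inner ℂ (Q x) y = inner ℂ x (Q y) := fun x y => by
    conv_lhs => rw [← hQs.adjoint_eq]
    rw [ContinuousLinearMap.adjoint_inner_left]
  calc traceNorm T
      = ∑' e, ENNReal.ofReal (inner ℂ (c e) (CFC.abs T (c e))).re := by rw [traceNorm, hc]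
    _ = ∑' e, ∑' k, ‖inner ℂ (Q (c e)) (b k)‖ₑ ^ 2 := by
      simp_rw [← hQ, ofReal_inner_mul_self b hQ']
    _ = ∑' k, ∑' e, ‖inner ℂ (Q (c e)) (b k)‖ₑ ^ 2 := ENNReal.tsum_comm
    _ = ∑' k, ∑' e, ‖inner ℂ (Q (b k)) (c e)‖ₑ ^ 2 := by
      congr 1 with k
      congr 1 with e
      rw [hQ', ← inner_conj_symm, RCLike.enorm_conj]
    _ = _ := by simp_rw [← hQ, ofReal_inner_mul_self c hQ']

end Hilbert

/-! ### Function spaces on `ℝ^d` -/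

/-- `ℝ^d`. -/
abbrev Space (d : ℕ) : Type := EuclideanSpace ℝ (Fin d)

/-- `ℂ^n` with its Euclidean norm. -/
abbrev Spinor (n : ℕ) : Type := EuclideanSpace ℂ (Fin n)

/-- The `n × n` complex matrices, normed by the operator norm on `ℂ^n`. -/
abbrev Mat (n : ℕ) : Type := Matrix (Fin n) (Fin n) ℂ

/-- The Hilbert space `L²(ℝ^d, ℂ^n)`. -/
abbrev L2 (d n : ℕ) : Type := Lp (Spinor n) 2 (volume : Measure (Space d))

/-- The space `L^∞(ℝ^d, M_n(ℂ))`. -/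
abbrev LinftyMat (d n : ℕ) : Type := Lp (Mat n) ∞ (volume : Measure (Space d))

variable {d n : ℕ}

/-- The lattice point `k ∈ ℤ^d` as a point of `ℝ^d`. -/
def latticePoint (k : Fin d → ℤ) : Space d := WithLp.toLp 2 fun j => (k j : ℝ)

/-- `g` is the weak (distributional) partial derivative `∂f/∂x_j`, where `f` and `g` are
`L^p` functions on `ℝ^d` with values in `F`. -/
def HasWeakPartial {F : Type*} [NormedAddCommGroup F] [NormedSpace ℂ F] [CompleteSpace F]
    {p : ℝ≥0∞} [Fact (1 ≤ p)] (j : Fin d) (f g : Lp F p (volume : Measure (Space d))) : Prop :=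
  ∂_{EuclideanSpace.single j (1 : ℝ)} (f : 𝓢'(Space d, F)) = (g : 𝓢'(Space d, F))

/-- `A ∈ W^{1,∞}(ℝ^d, M_n(ℂ))`. -/
def MemW1Infty (A : LinftyMat d n) : Prop := ∀ j, ∃ B : LinftyMat d n, HasWeakPartial j A B

/-- The graph of the weak partial derivative `∂/∂x_j` in `L²(ℝ^d, ℂ^n)`. -/
def weakPartialGraph (d n : ℕ) (j : Fin d) : Submodule ℂ (L2 d n × L2 d n) where
  carrier := {x | HasWeakPartial j x.1 x.2}
  add_mem' {x y} hx hy := by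
    simp only [Set.mem_ofPred_eq, HasWeakPartial, ← Lp.toTemperedDistributionCLM_apply] at hx hy ⊢
    rw [Prod.fst_add, Prod.snd_add, map_add, map_add, LineDeriv.lineDerivOp_add, hx, hy]
  zero_mem' := by
    simp only [Set.mem_ofPred_eq, HasWeakPartial, ← Lp.toTemperedDistributionCLM_apply]
    rw [Prod.fst_zero, Prod.snd_zero, map_zero, LineDeriv.lineDerivOp_zero]
  smul_mem' c x hx := by
    simp only [Set.mem_ofPred_eq, HasWeakPartial, ← Lp.toTemperedDistributionCLM_apply] at hx ⊢
    rw [Prod.smul_fst, Prod.smul_snd, map_smul, map_smul, LineDeriv.lineDerivOp_smul, hx]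

/-- The weak partial derivative `∂/∂x_j` as an unbounded operator in `L²(ℝ^d, ℂ^n)`, with its
maximal domain: all `ψ ∈ L²` whose distributional derivative `∂ψ/∂x_j` belongs to `L²`. -/
def weakPartial (d n : ℕ) (j : Fin d) : L2 d n →ₗ.[ℂ] L2 d n :=
  (weakPartialGraph d n j).toLinearPMap

theorem mem_graph_weakPartial {j : Fin d} {ψ η : L2 d n} :
    (ψ, η) ∈ (weakPartial d n j).graph ↔ HasWeakPartial j ψ η := by
  rw [weakPartial, Submodule.toLinearPMap_graph_eq]
  · rfl
  · rintro ⟨ψ, η⟩ h (rfl : ψ = 0)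
    have h' : HasWeakPartial j (0 : L2 d n) η := h
    simp only [HasWeakPartial, ← Lp.toTemperedDistributionCLM_apply] at h'
    rw [map_zero, LineDeriv.lineDerivOp_zero] at h'
    have hη : η ∈ (Lp.toTemperedDistributionCLM (Spinor n) (volume : Measure (Space d)) 2).ker :=
      h'.symm
    rwa [Lp.ker_toTemperedDistributionCLM_eq_bot] at hη

/-- The Sobolev space `H¹(ℝ^d, ℂ^n)`. -/
def sobolevH1 (d n : ℕ) : Submodule ℂ (L2 d n) := ⨅ j, (weakPartial d n j).domain

/-- The operator on `L²(ℝ^d, ℂ^n)` of multiplication by `A ∈ L^∞(ℝ^d, M_n(ℂ))`. -/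
def mulOp (A : LinftyMat d n) : L2 d n →L[ℂ] L2 d n :=
  ContinuousLinearMap.holderL volume ∞ 2 2
    (LinearMap.toContinuousLinearMap
      (Matrix.toEuclideanCLM (n := Fin n) (𝕜 := ℂ)).toAlgEquiv.toLinearMap) A

theorem mulOp_apply_ae (A : LinftyMat d n) (ψ : L2 d n) :
    mulOp A ψ =ᵐ[volume] fun x => WithLp.toLp 2 ((A x).mulVec (ψ x).ofLp) := by
  filter_upwards [ContinuousLinearMap.coeFn_holder (r := 2) (LinearMap.toContinuousLinearMap
    (Matrix.toEuclideanCLM (n := Fin n) (𝕜 := ℂ)).toAlgEquiv.toLinearMap) A ψ] with x hx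
  exact hx

/-- The operator on `L²(ℝ^d, ℂ^n)` of multiplication by a constant matrix. -/
def constMulOp (d : ℕ) (A : Mat n) : L2 d n →L[ℂ] L2 d n :=
  (Matrix.toEuclideanCLM (n := Fin n) (𝕜 := ℂ) A).compLpL 2 volume

/-! ### The unperturbed operator -/

/-- Ellipticity of `σ·(-i∇)`: `‖(σ·p) v‖ ≥ c ‖p‖ ‖v‖` for some `c > 0`. -/
def IsElliptic (σ : Fin d → Mat n) : Prop :=
  ∃ c : ℝ, 0 < c ∧ ∀ (p : Space d) (v : Spinor n),
    c * ‖p‖ * ‖v‖ ≤ ‖Matrix.toEuclideanCLM (n := Fin n) (𝕜 := ℂ) (∑ j, (p j : ℂ) • σ j) v‖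

/-- `0 < S₋ I_n ≤ S(x) ≤ S₊ I_n` for almost every `x`, in the order of Hermitian matrices. -/
def IsCoefficientPositive (S : LinftyMat d n) : Prop :=
  ∃ a b : ℝ, 0 < a ∧ 0 < b ∧ ∀ᵐ x, (S x - (a : ℂ) • (1 : Mat n)).PosSemidef ∧
    ((b : ℂ) • (1 : Mat n) - S x).PosSemidef

/-- `ℤ^d`-periodicity. -/
def IsLatticePeriodic (A : LinftyMat d n) : Prop :=
  ∀ k : Fin d → ℤ, ∀ᵐ x, A (x + latticePoint k) = A x

/-- The operator `D₀ = σ·(-i∇) = ∑_j σ_j (-i ∂/∂x_j)` in `L²(ℝ^d, ℂ^n)`, with domain `H¹`. -/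
def freeOp (σ : Fin d → Mat n) : L2 d n →ₗ.[ℂ] L2 d n where
  domain := sobolevH1 d n
  toFun := ∑ j, (-Complex.I) • ((constMulOp d (σ j)).toLinearMap ∘ₗ (weakPartial d n j).toFun ∘ₗ
    Submodule.inclusion (iInf_le (fun j => (weakPartial d n j).domain) j))

/-- The operator `H₀ = S D₀ S + V₀` in `L²(ℝ^d, ℂ^n)`, with the domain of the composition
`S D₀ S`, that is, all `ψ ∈ L²` with `S ψ ∈ H¹`. For `S ∈ W^{1,∞}` with `S₋ I_n ≤ S` both `S` and
`S⁻¹` map `H¹` into itself, so that this domain is `H¹`. -/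
def gappedOp (σ : Fin d → Mat n) (S V₀ : LinftyMat d n) : L2 d n →ₗ.[ℂ] L2 d n where
  domain := (freeOp σ).domain.comap (mulOp S).toLinearMap
  toFun := (mulOp S).toLinearMap ∘ₗ (freeOp σ).toFun ∘ₗ
      (mulOp S).toLinearMap.restrict (fun _ h => h) +
    (mulOp V₀).toLinearMap ∘ₗ Submodule.subtype _

/-! ### Boxes, single-site potentials, and the products -/

/-- The open box of side `L` centred at `x ∈ ℤ^d` (a ball of radius `L/2` for the sup norm). -/
def box (x : Fin d → ℤ) (L : ℕ) : Set (Space d) := {y | ∀ j, |y j - x j| < (L : ℝ) / 2}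

/-- The lattice sites in the box. -/
def latticeBox (x : Fin d → ℤ) (L : ℕ) : Set (Fin d → ℤ) := {k | latticePoint k ∈ box x L}

/-- The operator of multiplication by the translate `u(· - a)` of a bounded function `u`. -/
def translateMulOp (u : Space d → Mat n) (hu : MemLp u ∞ volume) (a : Space d) :
    L2 d n →L[ℂ] L2 d n :=
  mulOp ((hu.comp_measurePreserving (measurePreserving_sub_right volume a)).toLp
    (u ∘ fun x => x - a))

/-- The product `U₁ R U₂ R ⋯ U_{q-1} R² U_q`. The factors are indexed by `k = 0, …, q - 1`: the
last one is followed by nothing, the last but one by `R²`, and every other one by `R`. -/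
def resolventProduct {H : Type*} [NormedAddCommGroup H] [NormedSpace ℂ H] (R : H →L[ℂ] H) {q : ℕ}
    (U : Fin q → H →L[ℂ] H) : H →L[ℂ] H :=
  (List.ofFn fun k : Fin q =>
    U k * R ^ (if (k : ℕ) + 1 = q then 0 else if (k : ℕ) + 2 = q then 2 else 1)).prod

end GappedDirac

end

/-!
The trace norm of `K = u_{i₁} R₀ u_{i₂} R₀ ⋯ R₀² u_{i_q}` decays in all the distances between
consecutive sites, uniformly in the energy, the sites and the displacements; summing over the
tuples one site at a time then leaves only the sum over the last site, and hence the number of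
lattice points of the box, which is at most its volume (`tsum_prod_chain_le`, `tsum_latticeBox_le`).

The trace norm is estimated through Gelfand numbers, that is, through the norm of the operator on
the orthogonal complement of `m` vectors. They are submultiplicative by composition, and the trace
norm is at most their sum, as one sees in an orthonormal basis adapted to the vectors
(`traceNorm_le_tsum`). No Schatten classes and no Hölder inequality for them are needed.

* *Compactness.* Let `χᵢ` be the indicator function of a cube that contains the support of `uᵢ`.
  If `S R₀ f` has mean zero on the small cubes of side `1 / N` that make up the cube of `χᵢ`,
  which is a condition of orthogonality to `O(N^d)` vectors, then `χᵢ R₀ f` is of size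
  `O(‖f‖ / N)`. This is a Poincaré inequality (`norm_cutoff_le`) for functions with Lipschitz
  translates in `L²`; by Plancherel and ellipticity, the Lipschitz constant of `φ = S R₀ f` is
  controlled by `D₀ φ` (`norm_translation_sub_le`), and `D₀ φ` by the resolvent equation. So
  `χᵢ R₀` has Gelfand numbers of order `m^(-1/d)` (`isGelfandBound_cutoff_mul_resolvent`), and
  since `K` contains `q - 1 ≥ 2 d` such factors, its Gelfand numbers are of order `m⁻²`.
* *Decay.* The commutator of `H₀` with the weight `(1 + δ² |x - a|²)^(-s)` is bounded by a small
  multiple of the weight if `δ` is small. So `R₀` is bounded with respect to all these weights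
  (`norm_decayWeight_resolvent_le`), which gives a polynomial decay of any order for `χᵢ R₀ χₖ` and
  `χᵢ R₀² χₖ`, and hence for the operator norm of `K`. Polynomial weights suffice, as only
  summability over the lattice matters.
* *Interpolation.* If the Gelfand numbers are at most `min (‖K‖, C m⁻²)`, then they are at most
  `‖K‖^(1/4) (C m⁻²)^(3/4)`, which is summable in `m`. The trace norm thus inherits the decay of the
  operator norm, up to a fourth root (`exists_traceNorm_le_of_isGelfandBound`).

All the constants depend on the energy only through its modulus and the norm of `R₀`, which is
bounded on compact subsets of the resolvent set (`exists_norm_resolvent_le`).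
-/

namespace GappedDirac

open Filter Topology FourierTransform

/-! ### Gelfand numbers and the trace norm -/

section Gelfand

variable {H : Type*} [NormedAddCommGroup H] [InnerProductSpace ℂ H]

/-- `T` is bounded by `ε` on the orthogonal complement of `m` vectors, that is, the `m`-th Gelfand
number of `T` is at most `ε`. The vectors need not be independent. -/
def IsGelfandBound (T : H →L[ℂ] H) (m : ℕ) (ε : ℝ) : Prop :=
  ∃ s : Fin m → H, ∀ f, (∀ i, inner ℂ (s i) f = 0) → ‖T f‖ ≤ ε * ‖f‖

theorem isGelfandBound_of_norm_le {T : H →L[ℂ] H} {M : ℝ} (hT : ‖T‖ ≤ M) :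
    IsGelfandBound T 0 M :=
  ⟨Fin.elim0, fun f _ => T.le_of_opNorm_le hT f⟩

theorem IsGelfandBound.mono {T : H →L[ℂ] H} {m : ℕ} {ε ε' : ℝ} (h : IsGelfandBound T m ε)
    (hε : ε ≤ ε') : IsGelfandBound T m ε' := by
  obtain ⟨s, hs⟩ := h
  exact ⟨s, fun f hf => (hs f hf).trans (by gcongr)⟩

theorem IsGelfandBound.mul [CompleteSpace H] {A B : H →L[ℂ] H} {m k : ℕ} {α β : ℝ}
    (hα : 0 ≤ α) (hA : IsGelfandBound A m α) (hB : IsGelfandBound B k β) :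
    IsGelfandBound (A * B) (m + k) (α * β) := by
  obtain ⟨s, hs⟩ := hA
  obtain ⟨t, ht⟩ := hB
  -- `f ⟂ B† sᵢ` says that `B f ⟂ sᵢ`
  refine ⟨Fin.append (fun i => ContinuousLinearMap.adjoint B (s i)) t, fun f hf => ?_⟩
  have h1 : ∀ i, inner ℂ (s i) (B f) = 0 := fun i => by
    have := hf (Fin.castAdd k i)
    rwa [Fin.append_left, ContinuousLinearMap.adjoint_inner_left] at this
  have h2 : ∀ i, inner ℂ (t i) f = 0 := fun i => by
    have := hf (Fin.natAdd m i)
    rwa [Fin.append_right] at this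
  calc ‖(A * B) f‖ = ‖A (B f)‖ := rfl
    _ ≤ α * ‖B f‖ := hs _ h1
    _ ≤ α * (β * ‖f‖) := by gcongr; exact ht f h2
    _ = _ := by ring

theorem IsGelfandBound.prod_ofFn [CompleteSpace H] {m : ℕ} {ε M : ℝ} (hε : 0 ≤ ε) :
    ∀ {q : ℕ} (F : Fin (q + 1) → H →L[ℂ] H),
      (∀ k : Fin q, IsGelfandBound (F k.castSucc) m ε) → ‖F (Fin.last q)‖ ≤ M →
      IsGelfandBound (List.ofFn F).prod (q * m) (ε ^ q * M)
  | 0, F, _, hM => by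
    have : (List.ofFn F).prod = F (Fin.last 0) := by simp
    rw [this, zero_mul, pow_zero, one_mul]
    exact isGelfandBound_of_norm_le hM
  | q + 1, F, hF, hM => by
    rw [List.ofFn_succ, List.prod_cons]
    have h := (hF 0).mul hε (IsGelfandBound.prod_ofFn hε (fun k => F k.succ)
      (fun k => hF k.succ) hM)
    convert h using 1
    · rfl
    · ring
    · ring

variable [CompleteSpace H]

theorem re_inner_abs_le (T : H →L[ℂ] H) (f : H) (hf : ‖f‖ = 1) :
    (inner ℂ f (CFC.abs T f)).re ≤ ‖T f‖ := by
  have h1 : ‖CFC.abs T f‖ ^ 2 = ‖T f‖ ^ 2 := by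
    have hsa : ContinuousLinearMap.adjoint (CFC.abs T) = CFC.abs T :=
      (CFC.abs_nonneg T).isSelfAdjoint.adjoint_eq
    have e : inner ℂ (CFC.abs T f) (CFC.abs T f) = inner ℂ (T f) (T f) := by
      rw [← ContinuousLinearMap.adjoint_inner_right, ← ContinuousLinearMap.adjoint_inner_right,
        hsa]
      exact congrArg (fun A : H →L[ℂ] H => inner ℂ f (A f)) (CFC.abs_mul_abs T)
    rw [@norm_sq_eq_re_inner ℂ, @norm_sq_eq_re_inner ℂ _ _ _ _ (T f), e]
  have h2 : ‖CFC.abs T f‖ = ‖T f‖ := by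
    rwa [sq_eq_sq₀ (norm_nonneg _) (norm_nonneg _)] at h1
  calc (inner ℂ f (CFC.abs T f)).re ≤ ‖inner ℂ f (CFC.abs T f)‖ := Complex.re_le_norm _
    _ ≤ ‖f‖ * ‖CFC.abs T f‖ := norm_inner_le_norm _ _
    _ = ‖T f‖ := by rw [hf, one_mul, h2]

/-- The trace norm is at most the sum of the Gelfand numbers, when these are realised along one
sequence `v`: in an orthonormal basis that extends the Gram-Schmidt system of `v`, the diagonal
entries of `|T|` are dominated by the numbers `a n`. -/
theorem traceNorm_le_tsum (T : H →L[ℂ] H) (v : ℕ → H) (a : ℕ → ℝ) (ha : Tendsto a atTop (𝓝 0))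
    (h : ∀ n f, (∀ m < n, inner ℂ (v m) f = 0) → ‖T f‖ ≤ a n * ‖f‖) :
    traceNorm T ≤ ∑' n, ENNReal.ofReal (a n) := by
  set e : ℕ → H := InnerProductSpace.gramSchmidtNormed ℂ v with he
  have heo := InnerProductSpace.gramSchmidtNormed_orthonormal' (𝕜 := ℂ) v
  obtain ⟨w, b, hsw, hb⟩ := heo.toSubtypeRange.exists_hilbertBasis_extension
  set J : Set ℕ := {i | e i ≠ 0} with hJ
  have hnorm : ∀ k : w, ‖(k : H)‖ = 1 := fun k => by
    have := b.orthonormal.1 k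
    rwa [hb] at this
  have horth : ∀ k l : w, (k : H) ≠ l → inner ℂ (k : H) (l : H) = 0 := fun k l hkl => by
    have := b.orthonormal.2 (i := k) (j := l) (fun h => hkl (by rw [h]))
    rwa [hb] at this
  let G : J → w := fun j => ⟨e j, hsw ⟨j, rfl⟩⟩
  have hG : Function.Injective G := fun i j hij =>
    heo.linearIndependent.injective (congrArg Subtype.val hij)
  -- the vectors of the basis outside the Gram-Schmidt system are orthogonal to all of `v`
  have hout : ∀ k : w, k ∉ Set.range G → T k = 0 := fun k hk => by
    have h1 : ∀ n, inner ℂ (k : H) (e n) = 0 := fun n => by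
      by_cases hn : e n = 0
      · rw [hn, inner_zero_right]
      · exact horth k (G ⟨n, hn⟩) fun hh => hk ⟨⟨n, hn⟩, Subtype.ext hh.symm⟩
    have h2 : ∀ n, inner ℂ (v n) (k : H) = 0 := fun n => by
      have hv : v n ∈ Submodule.span ℂ (Set.range e) := by
        rw [he, InnerProductSpace.span_gramSchmidtNormed_range, InnerProductSpace.span_gramSchmidt]
        exact Submodule.subset_span ⟨n, rfl⟩
      rw [← inner_conj_symm]
      have : Submodule.span ℂ (Set.range e) ≤ (innerₛₗ ℂ (k : H)).ker :=
        Submodule.span_le.2 (by rintro _ ⟨m, rfl⟩; exact h1 m)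
      have h3 : inner ℂ (k : H) (v n) = 0 := this hv
      rw [h3, map_zero]
    have h3 : ‖T k‖ ≤ 0 := by
      refine ge_of_tendsto ha (Eventually.of_forall fun n => ?_)
      simpa [hnorm k] using h n k (fun m _ => h2 m)
    simpa using h3
  have hle : ∀ k : w, ENNReal.ofReal (inner ℂ (b k) (CFC.abs T (b k))).re ≤
      ENNReal.ofReal ‖T k‖ := fun k => by
    rw [hb]
    exact ENNReal.ofReal_le_ofReal (re_inner_abs_le T k (hnorm k))
  rw [traceNorm_eq b]
  calc ∑' k, ENNReal.ofReal (inner ℂ (b k) (CFC.abs T (b k))).re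
      ≤ ∑' k : w, ENNReal.ofReal ‖T k‖ := ENNReal.tsum_le_tsum hle
    _ = ∑' j : J, ENNReal.ofReal ‖T (G j)‖ := by
      refine (hG.tsum_eq (f := fun k : w => ENNReal.ofReal ‖T k‖) fun k hk => ?_).symm
      by_contra hk'
      exact hk (by simp [hout k hk'])
    _ ≤ ∑' j : J, ENNReal.ofReal (a j) := by
      refine ENNReal.tsum_le_tsum fun j => ENNReal.ofReal_le_ofReal ?_
      refine (h j (e j) fun m hm => ?_).trans_eq (by rw [hnorm (G j), mul_one])
      rw [he, InnerProductSpace.gramSchmidtNormed, inner_smul_right, ← inner_conj_symm,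
        InnerProductSpace.gramSchmidt_inv_triangular ℂ v hm, map_zero, mul_zero]
    _ ≤ _ := ENNReal.tsum_comp_le_tsum_of_injective Subtype.val_injective _

/-- If the Gelfand numbers of `T` decay like `m⁻²`, then interpolation with the operator norm shows
that the trace norm is controlled by the fourth root of the operator norm. -/
theorem exists_traceNorm_le_of_isGelfandBound (H : Type*) [NormedAddCommGroup H]
    [InnerProductSpace ℂ H] [CompleteSpace H] {D B : ℕ} (hD : 0 < D) (hB : 2 ≤ B) {C : ℝ}
    (hC : 0 ≤ C) :
    ∃ C' : ℝ, 0 < C' ∧ ∀ T : H →L[ℂ] H,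
      (∀ k : ℕ, IsGelfandBound T (D * B ^ k) (C / ((B : ℝ) ^ k) ^ 2)) → ‖T‖ ≤ C →
      ∀ p : ℝ, 0 ≤ p → ‖T‖ ≤ p ^ 4 → traceNorm T ≤ ENNReal.ofReal (C' * p) := by
  set C₂ : ℝ := C * (D * B ^ 2) ^ 2 with hC₂
  have hC₂0 : 0 ≤ C₂ := by positivity
  have hsum : Summable fun n : ℕ => (((n : ℝ) + 1) ^ (3 / 2 : ℝ))⁻¹ := by
    have := (summable_nat_add_iff 1).2
      (Real.summable_nat_rpow_inv.2 (by norm_num : (1 : ℝ) < 3 / 2))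
    simpa using this
  refine ⟨C₂ ^ (3 / 4 : ℝ) * (∑' n : ℕ, (((n : ℝ) + 1) ^ (3 / 2 : ℝ))⁻¹) + 1, by positivity,
    fun T hT hTC p hp hTp => ?_⟩
  choose s hs using hT
  -- the family `s k` is listed at the positions `D * B ^ k, …, 2 * D * B ^ k - 1`
  let v : ℕ → H := fun n =>
    if h : n - D * B ^ Nat.log B (n / D) < D * B ^ Nat.log B (n / D) then
      s (Nat.log B (n / D)) ⟨_, h⟩ else 0
  have hv : ∀ k (i : Fin (D * B ^ k)), v (D * B ^ k + i) = s k i := fun k i => by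
    have hi := i.2
    have hlog : Nat.log B ((D * B ^ k + i) / D) = k := by
      have h1 : B ^ k ≤ (D * B ^ k + i) / D := by
        rw [Nat.le_div_iff_mul_le hD]; nlinarith
      have h2 : (D * B ^ k + i) / D < B ^ (k + 1) := by
        rw [Nat.div_lt_iff_lt_mul hD, pow_succ]
        nlinarith [Nat.mul_le_mul_left (D * B ^ k) hB]
      exact Nat.log_eq_of_pow_le_of_lt_pow h1 h2
    have hn : D * B ^ k + (i : ℕ) - D * B ^ k = i := by lia
    simp only [v]
    rw [dif_pos (by rw [hlog, hn]; exact hi)]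
    have haux : ∀ l j (h : j < D * B ^ l), l = k → j = i → s l ⟨j, h⟩ = s k i := by
      rintro l j h rfl rfl; rfl
    exact haux _ _ _ hlog (by rw [hlog, hn])
  have hB0 : (0 : ℝ) < B := by exact_mod_cast (by lia : 0 < B)
  have hkey : ∀ n f, (∀ m < n, inner ℂ (v m) f = 0) → ‖T f‖ ≤ C₂ / ((n : ℝ) + 1) ^ 2 * ‖f‖ := by
    intro n f hf
    rcases lt_or_ge n (D * B) with hn | hn
    · refine (T.le_of_opNorm_le hTC f).trans ?_
      gcongr
      rw [le_div_iff₀ (by positivity), hC₂]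
      have : (n : ℝ) + 1 ≤ D * B := by exact_mod_cast hn
      have h2 : (D : ℝ) * B ≤ D * B ^ 2 := by
        have : (1 : ℝ) ≤ B := by exact_mod_cast (by lia : 1 ≤ B)
        gcongr; nlinarith
      gcongr
      exact this.trans h2
    · have hnD : B ≤ n / D := by rw [Nat.le_div_iff_mul_le hD]; lia
      have hlog1 : 1 ≤ Nat.log B (n / D) := Nat.log_pos (by lia) hnD
      obtain ⟨k, hk⟩ : ∃ k, Nat.log B (n / D) = k + 1 := ⟨_, (Nat.sub_add_cancel hlog1).symm⟩
      have h1 : B ^ (k + 1) ≤ n / D := hk ▸ Nat.pow_log_le_self B (by lia)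
      have h2 : n / D < B ^ (k + 2) := by
        have := Nat.lt_pow_succ_log_self (b := B) (by lia) (n / D)
        rwa [hk] at this
      have h1' : D * B ^ (k + 1) ≤ n := by
        rw [Nat.le_div_iff_mul_le hD] at h1; lia
      have h2' : n + 1 ≤ D * B ^ (k + 2) := by
        rw [Nat.div_lt_iff_lt_mul hD] at h2; lia
      refine (hs k f fun i => ?_).trans ?_
      · rw [← hv]
        refine hf _ (lt_of_lt_of_le ?_ h1')
        have := i.2
        rw [pow_succ]
        nlinarith [Nat.mul_le_mul_left (D * B ^ k) hB]
      · gcongr ?_ * _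
        rw [div_le_div_iff₀ (by positivity) (by positivity), hC₂]
        have h3 : (n : ℝ) + 1 ≤ D * B ^ 2 * B ^ k := by
          have : ((n + 1 : ℕ) : ℝ) ≤ ((D * B ^ (k + 2) : ℕ) : ℝ) := by exact_mod_cast h2'
          push_cast at this
          rw [pow_add] at this
          linarith
        calc C * ((n : ℝ) + 1) ^ 2 ≤ C * (D * B ^ 2 * B ^ k) ^ 2 := by gcongr
          _ = _ := by ring
  have hmin : ∀ n : ℕ, min (p ^ 4) (C₂ / ((n : ℝ) + 1) ^ 2) ≤
      p * C₂ ^ (3 / 4 : ℝ) * (((n : ℝ) + 1) ^ (3 / 2 : ℝ))⁻¹ := fun n => by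
    set y := C₂ / ((n : ℝ) + 1) ^ 2 with hy
    have hy0 : 0 ≤ y := by positivity
    have hm0 : 0 ≤ min (p ^ 4) y := le_min (by positivity) hy0
    calc min (p ^ 4) y = min (p ^ 4) y ^ (1 / 4 : ℝ) * min (p ^ 4) y ^ (3 / 4 : ℝ) := by
          rw [← Real.rpow_add' hm0 (by norm_num)]; norm_num
      _ ≤ (p ^ 4) ^ (1 / 4 : ℝ) * y ^ (3 / 4 : ℝ) := by
          gcongr
          · exact min_le_left _ _
          · exact min_le_right _ _
      _ = p * (C₂ ^ (3 / 4 : ℝ) / (((n : ℝ) + 1) ^ (3 / 2 : ℝ))) := by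
          congr 1
          · rw [← Real.rpow_natCast, ← Real.rpow_mul hp]; norm_num
          · rw [hy, Real.div_rpow hC₂0 (by positivity), ← Real.rpow_natCast,
              ← Real.rpow_mul (by positivity)]
            norm_num
      _ = _ := by ring
  have ht : Tendsto (fun n : ℕ => min (p ^ 4) (C₂ / ((n : ℝ) + 1) ^ 2)) atTop (𝓝 0) := by
    refine squeeze_zero (fun n => by positivity) hmin ?_
    simpa using hsum.tendsto_atTop_zero.const_mul (p * C₂ ^ (3 / 4 : ℝ))
  calc traceNorm T ≤ ∑' n : ℕ, ENNReal.ofReal (min (p ^ 4) (C₂ / ((n : ℝ) + 1) ^ 2)) := by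
        refine traceNorm_le_tsum T v _ ht fun n f hf => ?_
        rw [min_mul_of_nonneg _ _ (norm_nonneg _)]
        exact le_min (T.le_of_opNorm_le hTp f) (hkey n f hf)
    _ ≤ ∑' n : ℕ, ENNReal.ofReal (p * C₂ ^ (3 / 4 : ℝ) * (((n : ℝ) + 1) ^ (3 / 2 : ℝ))⁻¹) :=
        ENNReal.tsum_le_tsum fun n => ENNReal.ofReal_le_ofReal (hmin n)
    _ = ENNReal.ofReal (p * C₂ ^ (3 / 4 : ℝ) * ∑' n : ℕ, (((n : ℝ) + 1) ^ (3 / 2 : ℝ))⁻¹) := by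
        rw [← tsum_mul_left, ENNReal.ofReal_tsum_of_nonneg (fun n => by positivity)
          (hsum.mul_left _)]
    _ ≤ _ := ENNReal.ofReal_le_ofReal (by nlinarith)

end Gelfand

/-! ### Products with cutoffs -/

/-- A cutoff `χ k` that acts as the identity on `U k` from both sides can be inserted next to it, so
that only the localised operators `χ k * T k * χ (k + 1)` enter the norm of the product. -/
theorem norm_prod_ofFn_le {A : Type*} [NormedRing A] {M : ℝ} (hM : 0 ≤ M) :
    ∀ {q : ℕ} (U T χ : Fin (q + 1) → A) (c : Fin q → ℝ), (∀ k, ‖U k‖ ≤ M) →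
      (∀ k, χ k * U k = U k) → (∀ k, U k * χ k = U k) →
      (∀ k : Fin q, ‖χ k.castSucc * T k.castSucc * χ k.succ‖ ≤ c k) →
      T (Fin.last q) = 1 → ‖(List.ofFn fun k => U k * T k).prod‖ ≤ M ^ (q + 1) * ∏ k, c k
  | 0, U, T, χ, c, hU, _, _, _, hT => by
    have h : (List.ofFn fun k => U k * T k).prod = U 0 := by
      have : T 0 = 1 := hT
      simp [this]
    rw [h]
    simpa using hU 0
  | q + 1, U, T, χ, c, hU, hl, hr, hc, hT => by
    have ih := norm_prod_ofFn_le hM (fun k => U k.succ) (fun k => T k.succ) (fun k => χ k.succ)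
      (fun k => c k.succ) (fun k => hU _) (fun k => hl _) (fun k => hr _) (fun k => hc k.succ) hT
    set P := (List.ofFn fun k : Fin (q + 1) => U k.succ * T k.succ).prod with hP
    have hP1 : χ 1 * P = P := by
      rw [hP, List.ofFn_succ, List.prod_cons, ← mul_assoc, ← mul_assoc]
      congr 2
      exact hl 1
    have hc0 : ‖χ 0 * T 0 * χ 1‖ ≤ c 0 := hc 0
    rw [List.ofFn_succ, List.prod_cons, ← hP]
    have h0 : U 0 * T 0 * P = U 0 * ((χ 0 * T 0 * χ 1) * P) := by
      rw [mul_assoc (χ 0 * T 0), hP1, ← mul_assoc, ← mul_assoc, hr 0]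
    rw [h0, Fin.prod_univ_succ]
    have hc00 : 0 ≤ c 0 := (norm_nonneg _).trans hc0
    calc _ ≤ ‖U 0‖ * (‖χ 0 * T 0 * χ 1‖ * ‖P‖) :=
          (norm_mul_le _ _).trans (by gcongr; exact norm_mul_le _ _)
      _ ≤ M * (c 0 * (M ^ (q + 1) * ∏ k : Fin q, c k.succ)) := by
          gcongr
          exact hU 0
      _ = _ := by ring

/-! ### Sums over lattice points -/

/-- Summing a nearest-neighbour product over tuples, one variable at a time. -/
theorem tsum_prod_chain_le {X : Type*} (ρ : X → X → ℝ≥0∞) (A : ℝ≥0∞)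
    (hA : ∀ y, ∑' x, ρ x y ≤ A) : ∀ q : ℕ,
      ∑' i : Fin (q + 1) → X, ∏ k : Fin q, ρ (i k.castSucc) (i k.succ) ≤ (∑' _ : X, 1) * A ^ q
  | 0 => by
    simp only [Finset.univ_eq_empty, Finset.prod_empty, pow_zero, mul_one]
    exact (ENNReal.tsum_comp_le_tsum_of_injective (Equiv.funUnique (Fin 1) X).injective
      (fun _ => 1))
  | q + 1 => by
    rw [← (Fin.consEquiv (fun _ : Fin (q + 2) => X)).tsum_eq, ENNReal.tsum_prod', ENNReal.tsum_comm]
    calc _ = ∑' i : Fin (q + 1) → X, (∑' a, ρ a (i 0)) *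
          ∏ k : Fin q, ρ (i k.castSucc) (i k.succ) := by
          congr 1 with i
          rw [← ENNReal.tsum_mul_right]
          congr 1 with a
          rw [Fin.prod_univ_succ]
          rfl
      _ ≤ ∑' i : Fin (q + 1) → X, A * ∏ k : Fin q, ρ (i k.castSucc) (i k.succ) := by
          gcongr with i
          exact hA _
      _ ≤ A * ((∑' _ : X, 1) * A ^ q) := by
          rw [ENNReal.tsum_mul_left]
          gcongr
          exact tsum_prod_chain_le ρ A hA q
      _ = _ := by ring

theorem tsum_pi_prod (f : ℤ → ℝ≥0∞) : ∀ d : ℕ,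
    ∑' z : Fin d → ℤ, ∏ j, f (z j) = (∑' z, f z) ^ d
  | 0 => by simp
  | d + 1 => by
    rw [← (Fin.consEquiv (fun _ : Fin (d + 1) => ℤ)).tsum_eq, ENNReal.tsum_prod', pow_succ',
      ← tsum_pi_prod f d, ← ENNReal.tsum_mul_right]
    congr 1 with a
    rw [← ENNReal.tsum_mul_left]
    congr 1 with z
    rw [Fin.prod_univ_succ]
    rfl

theorem tsum_inv_one_add_sq_lt_top {δ : ℝ} (hδ : 0 < δ) :
    ∑' z : ℤ, ENNReal.ofReal (1 + (δ * z) ^ 2)⁻¹ < ⊤ := by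
  have h1 : Summable fun z : ℤ => (δ ^ 2)⁻¹ * (1 / (z : ℝ) ^ 2) :=
    (Real.summable_one_div_int_pow.2 (by norm_num)).mul_left _
  have h2 : Summable fun z : ℤ => (1 + (δ * z) ^ 2)⁻¹ := by
    refine Summable.of_norm_bounded_eventually h1 ?_
    filter_upwards [(Set.finite_singleton (0 : ℤ)).compl_mem_cofinite] with z hz
    have hz0 : (z : ℝ) ≠ 0 := by exact_mod_cast hz
    rw [Real.norm_of_nonneg (by positivity), one_div, ← mul_inv, ← mul_pow]
    gcongr
    linarith
  rw [← ENNReal.ofReal_tsum_of_nonneg (fun z => by positivity) h2]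
  exact ENNReal.ofReal_lt_top

variable {d n : ℕ}

/-- The function `(1 + |z|²)^(-d)` is summable over a lattice, because `(1 + |z|²)^d` dominates
`∏ⱼ (1 + zⱼ²)`. -/
theorem exists_tsum_lattice_le {δ : ℝ} (hδ : 0 < δ) : ∃ A : ℝ≥0, ∀ y : Fin d → ℤ,
    ∑' x : Fin d → ℤ, ENNReal.ofReal
      (((1 + ‖δ • (latticePoint x - latticePoint y)‖ ^ 2) ^ d)⁻¹) ≤ A := by
  have hfin := (ENNReal.pow_lt_top (n := d) (tsum_inv_one_add_sq_lt_top hδ)).ne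
  refine ⟨((∑' z : ℤ, ENNReal.ofReal (1 + (δ * z) ^ 2)⁻¹) ^ d).toNNReal, fun y => ?_⟩
  rw [ENNReal.coe_toNNReal hfin, ← tsum_pi_prod,
    ← (Equiv.subRight y).tsum_eq (fun z => ∏ j, ENNReal.ofReal (1 + (δ * z j) ^ 2)⁻¹)]
  refine ENNReal.tsum_le_tsum fun x => ?_
  rw [← ENNReal.ofReal_prod_of_nonneg (fun _ _ => by positivity)]
  refine ENNReal.ofReal_le_ofReal ?_
  rw [Finset.prod_inv_distrib]
  refine inv_anti₀ (Finset.prod_pos fun _ _ => by positivity) ?_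
  calc ∏ j, (1 + (δ * ((Equiv.subRight y x j : ℤ) : ℝ)) ^ 2)
      ≤ ∏ _j : Fin d, (1 + ‖δ • (latticePoint x - latticePoint y)‖ ^ 2) := by
        refine Finset.prod_le_prod (fun _ _ => by positivity) fun j _ => ?_
        have h := PiLp.norm_apply_le (δ • (latticePoint x - latticePoint y)) j
        have h2 : (δ • (latticePoint x - latticePoint y)) j
            = δ * ((Equiv.subRight y x j : ℤ) : ℝ) := by
          simp [latticePoint]
        rw [h2, Real.norm_eq_abs] at h
        rw [← sq_abs]
        gcongr
    _ = _ := by simp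

theorem tsum_latticeBox_le (x : Fin d → ℤ) {L : ℕ} (hL : Even L) :
    ∑' _ : latticeBox x L, (1 : ℝ≥0∞) ≤ volume (box x L) := by
  obtain ⟨m, rfl⟩ := hL
  have hlat : latticeBox x (m + m) =
      (Fintype.piFinset fun j => Finset.Ioo (x j - m) (x j + m) : Finset (Fin d → ℤ)) := by
    ext k
    simp only [latticeBox, box, latticePoint, Set.mem_ofPred_eq, Finset.mem_coe,
      Fintype.mem_piFinset, Finset.mem_Ioo]
    refine forall_congr' fun j => ?_
    have h : (((m + m : ℕ) : ℝ)) / 2 = ((m : ℤ) : ℝ) := by push_cast; ring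
    rw [h]
    have : |(k j : ℝ) - x j| < ((m : ℤ) : ℝ) ↔ |k j - x j| < m := by exact_mod_cast Iff.rfl
    rw [this, abs_lt]
    constructor <;> intro h <;> constructor <;> linarith [h.1, h.2]
  have hbox : box x (m + m) = WithLp.ofLp ⁻¹'
      (Set.univ.pi fun j => Set.Ioo ((x j : ℝ) - m) (x j + m)) := by
    ext y
    simp only [box, Set.mem_ofPred_eq, Set.mem_preimage, Set.mem_univ_pi, Set.mem_Ioo]
    refine forall_congr' fun j => ?_
    have h : (((m + m : ℕ) : ℝ)) / 2 = m := by push_cast; ring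
    rw [h, abs_lt]
    constructor <;> intro h <;> constructor <;> linarith [h.1, h.2]
  rw [hbox, (PiLp.volume_preserving_ofLp (Fin d)).measure_preimage
    (MeasurableSet.univ_pi fun _ => measurableSet_Ioo).nullMeasurableSet, Real.volume_pi_Ioo, hlat]
  rw [Finset.tsum_subtype' _ (fun _ => (1 : ℝ≥0∞)), Finset.sum_const, nsmul_one,
    Fintype.card_piFinset]
  simp only [Int.card_Ioo, Nat.cast_prod]
  refine Finset.prod_le_prod' fun j _ => ?_
  rw [← ENNReal.ofReal_natCast]
  refine ENNReal.ofReal_le_ofReal ?_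
  have : ((x j + m - (x j - m) - 1).toNat : ℤ) ≤ m + m := by lia
  have h2 : ((x j + m - (x j - m) - 1).toNat : ℝ) ≤ m + m := by exact_mod_cast this
  linarith

/-! ### Multiplication operators -/

theorem norm_le_of_ae_norm_le {f g : L2 d n} {c : ℝ} (h : ∀ᵐ x, ‖f x‖ ≤ c * ‖g x‖) :
    ‖f‖ ≤ c * ‖g‖ :=
  Lp.norm_le_mul_norm_of_ae_le_mul h

theorem memLp_scalarMatrix {w : Space d → ℝ} (hw : MemLp w ∞ volume) :
    MemLp (fun x => (w x : ℂ) • (1 : Mat n)) ∞ volume := by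
  have := (Complex.ofRealCLM.smulRight (1 : Mat n)).comp_memLp' hw
  exact this

/-- Multiplication by a bounded real function on `L²(ℝ^d, ℂ^n)`. -/
noncomputable def scalarOp (n : ℕ) (w : Space d → ℝ) (hw : MemLp w ∞ volume) :
    L2 d n →L[ℂ] L2 d n :=
  mulOp ((memLp_scalarMatrix hw).toLp _)

theorem scalarOp_apply_ae {w : Space d → ℝ} (hw : MemLp w ∞ volume) (ψ : L2 d n) :
    scalarOp n w hw ψ =ᵐ[volume] fun x => (w x : ℂ) • ψ x := by
  filter_upwards [mulOp_apply_ae ((memLp_scalarMatrix hw).toLp _) ψ,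
    (memLp_scalarMatrix (n := n) hw).coeFn_toLp] with x h1 h2
  rw [scalarOp, h1, h2]
  simp [Matrix.smul_mulVec]

theorem constMulOp_apply_ae (A : Mat n) (ψ : L2 d n) :
    constMulOp d A ψ =ᵐ[volume] fun x => Matrix.toEuclideanCLM (n := Fin n) (𝕜 := ℂ) A (ψ x) :=
  ContinuousLinearMap.coeFn_compLpL _ _

theorem mulOp_scalarOp (A : LinftyMat d n) {w : Space d → ℝ} (hw : MemLp w ∞ volume)
    (ψ : L2 d n) : mulOp A (scalarOp n w hw ψ) = scalarOp n w hw (mulOp A ψ) := by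
  refine Lp.ext ?_
  filter_upwards [mulOp_apply_ae A (scalarOp n w hw ψ), scalarOp_apply_ae hw (mulOp A ψ),
    mulOp_apply_ae A ψ, scalarOp_apply_ae hw ψ] with x h1 h2 h3 h4
  rw [h1, h2, h3, h4]
  simp [Matrix.mulVec_smul]

theorem constMulOp_scalarOp (A : Mat n) {w : Space d → ℝ} (hw : MemLp w ∞ volume)
    (ψ : L2 d n) : constMulOp d A (scalarOp n w hw ψ) = scalarOp n w hw (constMulOp d A ψ) := by
  refine Lp.ext ?_
  filter_upwards [constMulOp_apply_ae A (scalarOp n w hw ψ),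
    scalarOp_apply_ae hw (constMulOp d A ψ), constMulOp_apply_ae A ψ, scalarOp_apply_ae hw ψ]
    with x h1 h2 h3 h4
  rw [h1, h2, h3, h4, map_smul]

theorem norm_scalarOp_apply_le {w w' : Space d → ℝ} (hw : MemLp w ∞ volume)
    (hw' : MemLp w' ∞ volume) {κ : ℝ} (h : ∀ x, |w' x| ≤ κ * |w x|) (ψ : L2 d n) :
    ‖scalarOp n w' hw' ψ‖ ≤ κ * ‖scalarOp n w hw ψ‖ := by
  refine norm_le_of_ae_norm_le ?_
  filter_upwards [scalarOp_apply_ae hw' ψ, scalarOp_apply_ae hw ψ] with x h1 h2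
  rw [h1, h2, norm_smul, norm_smul, Complex.norm_real, Complex.norm_real, Real.norm_eq_abs,
    Real.norm_eq_abs, ← mul_assoc]
  gcongr
  exact h x

/-! ### Weak derivatives -/

theorem integrable_schwartz_smul {F : Type*} [NormedAddCommGroup F] [NormedSpace ℂ F]
    (f : Lp F 2 (volume : Measure (Space d))) (η : 𝓢(Space d, ℂ)) :
    Integrable (fun x => η x • f x) :=
  memLp_one_iff_integrable.1 (MemLp.smul (p := 2) (q := 2) (r := 1) (Lp.memLp f) (η.memLp 2 volume))

theorem hasWeakPartial_iff {F : Type*} [NormedAddCommGroup F] [NormedSpace ℂ F]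
    [CompleteSpace F] {j : Fin d} {f g : Lp F 2 (volume : Measure (Space d))} :
    HasWeakPartial j f g ↔ ∀ η : 𝓢(Space d, ℂ),
      -∫ x, (∂_{EuclideanSpace.single j (1 : ℝ)} η) x • f x = ∫ x, η x • g x := by
  have h : ∀ η : 𝓢(Space d, ℂ), (∂_{EuclideanSpace.single j (1 : ℝ)} (f : 𝓢'(Space d, F))) η =
      -∫ x, (∂_{EuclideanSpace.single j (1 : ℝ)} η) x • f x := fun η => by
    rw [TemperedDistribution.lineDerivOp_apply_apply, map_neg, Lp.toTemperedDistribution_apply]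
  rw [HasWeakPartial]
  constructor
  · intro hfg η
    rw [← h, hfg, Lp.toTemperedDistribution_apply]
  · intro hfg
    ext η
    rw [h, hfg, Lp.toTemperedDistribution_apply]

/-- The Leibniz rule for the product with a smooth bounded function with bounded derivatives. -/
theorem HasWeakPartial.leibniz {j : Fin d} {φ g : L2 d n} (h : HasWeakPartial j φ g)
    {w w' : Space d → ℝ} (hwt : w.HasTemperateGrowth) (hw : MemLp w ∞ volume)
    (hw' : MemLp w' ∞ volume) (hd : ∀ x, w' x = fderiv ℝ w x (EuclideanSpace.single j (1 : ℝ))) :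
    HasWeakPartial j (scalarOp n w hw φ) (scalarOp n w hw g + scalarOp n w' hw' φ) := by
  rw [hasWeakPartial_iff] at h ⊢
  intro η
  have hwc : (fun x => (w x : ℂ)).HasTemperateGrowth :=
    Function.HasTemperateGrowth.comp Function.Complex.hasTemperateGrowth_ofReal hwt
  set θ : 𝓢(Space d, ℂ) := SchwartzMap.smulLeftCLM ℂ (fun x => (w x : ℂ)) η with hθ
  have hθx : ∀ x, θ x = (w x : ℂ) • η x := fun x => SchwartzMap.smulLeftCLM_apply_apply hwc η x
  have hθd : ∀ x, (∂_{EuclideanSpace.single j (1 : ℝ)} θ) x =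
      (w x : ℂ) * (∂_{EuclideanSpace.single j (1 : ℝ)} η) x + (w' x : ℂ) * η x := fun x => by
    have e : (θ : Space d → ℂ) = fun x => (w x) • η x := by
      ext x; rw [hθx]; simp
    rw [SchwartzMap.lineDerivOp_apply_eq_fderiv, SchwartzMap.lineDerivOp_apply_eq_fderiv, e,
      fderiv_fun_smul (hwt.1.differentiable (by simp) x) (η.differentiableAt)]
    simp [hd]
  have hφ := scalarOp_apply_ae hw φ
  have hφ' := scalarOp_apply_ae hw' φ
  have hg := scalarOp_apply_ae hw g
  have e1 : ∫ x, (∂_{EuclideanSpace.single j (1 : ℝ)} θ) x • φ x =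
      ∫ x, ((∂_{EuclideanSpace.single j (1 : ℝ)} η) x • (scalarOp n w hw φ) x +
        η x • (scalarOp n w' hw' φ) x) := by
    refine integral_congr_ae ?_
    filter_upwards [hφ, hφ'] with x h1 h2
    rw [hθd, h1, h2, add_smul, smul_smul, smul_smul, mul_comm (w x : ℂ), mul_comm (w' x : ℂ)]
  have e2 : ∫ x, θ x • g x = ∫ x, η x • (scalarOp n w hw g) x := by
    refine integral_congr_ae ?_
    filter_upwards [hg] with x h1
    rw [hθx, h1, smul_smul, smul_eq_mul, mul_comm]
  have e3 : ∫ x, η x • (scalarOp n w hw g + scalarOp n w' hw' φ : L2 d n) x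
      = ∫ x, (η x • (scalarOp n w hw g) x +
        η x • (scalarOp n w' hw' φ) x) := by
    refine integral_congr_ae ?_
    filter_upwards [Lp.coeFn_add (scalarOp n w hw g)
      (scalarOp n w' hw' φ)] with x h1
    rw [h1, Pi.add_apply, smul_add]
  have h0 := h θ
  rw [e1, e2, integral_add (integrable_schwartz_smul _ _) (integrable_schwartz_smul _ _)] at h0
  rw [e3, integral_add (integrable_schwartz_smul _ _) (integrable_schwartz_smul _ _), ← h0]
  abel

/-! ### The resolvent equation -/

/-- The value of `∑ⱼ σⱼ (-i gⱼ)` on a would-be gradient `g`. -/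
noncomputable def diracOp (σ : Fin d → Mat n) (g : Fin d → L2 d n) : L2 d n :=
  ∑ j, (-Complex.I) • constMulOp d (σ j) (g j)

theorem mem_sobolevH1_iff {φ : L2 d n} :
    φ ∈ sobolevH1 d n ↔ ∃ g : Fin d → L2 d n, ∀ j, HasWeakPartial j φ (g j) := by
  rw [sobolevH1, Submodule.mem_iInf, ← Classical.skolem (p := fun j g => HasWeakPartial j φ g)]
  refine forall_congr' fun j => ?_
  rw [LinearPMap.mem_domain_iff]
  simp_rw [mem_graph_weakPartial]

theorem freeOp_apply {σ : Fin d → Mat n} {φ : L2 d n} (hφ : φ ∈ (freeOp σ).domain)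
    {g : Fin d → L2 d n} (hg : ∀ j, HasWeakPartial j φ (g j)) :
    freeOp σ ⟨φ, hφ⟩ = diracOp σ g := by
  have h : ∀ j (hj : φ ∈ (weakPartial d n j).domain), weakPartial d n j ⟨φ, hj⟩ = g j :=
    fun j hj => by
      have h1 := mem_graph_weakPartial.2 (hg j)
      rw [LinearPMap.mem_graph_iff] at h1
      obtain ⟨y, hy1, hy2⟩ := h1
      refine Eq.trans ?_ hy2
      congr 1
      exact Subtype.ext hy1.symm
  change (∑ j, (-Complex.I) • ((constMulOp d (σ j)).toLinearMap ∘ₗ (weakPartial d n j).toFun ∘ₗ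
    Submodule.inclusion (iInf_le (fun j => (weakPartial d n j).domain) j))) ⟨φ, hφ⟩ = _
  rw [LinearMap.sum_apply, diracOp]
  refine Finset.sum_congr rfl fun j _ => ?_
  rw [← h j ((Submodule.mem_iInf _).1 hφ j)]
  rfl

/-- The defining property of the resolvent of `S D₀ S + V₀`, in terms of weak derivatives. -/
theorem IsResolventAt.apply_eq_iff {σ : Fin d → Mat n} {S V₀ : LinftyMat d n} {z : ℂ}
    {R : L2 d n →L[ℂ] L2 d n} (hR : IsResolventAt (gappedOp σ S V₀) z R) (f ψ : L2 d n) :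
    R f = ψ ↔ ∃ g : Fin d → L2 d n, (∀ j, HasWeakPartial j (mulOp S ψ) (g j)) ∧
      mulOp S (diracOp σ g) + mulOp V₀ ψ - z • ψ = f := by
  rw [hR f ψ]
  have key : ∀ (hψ : ψ ∈ (gappedOp σ S V₀).domain) (g : Fin d → L2 d n),
      (∀ j, HasWeakPartial j (mulOp S ψ) (g j)) →
      gappedOp σ S V₀ ⟨ψ, hψ⟩ = mulOp S (diracOp σ g) + mulOp V₀ ψ := fun hψ g hg => by
    rw [← freeOp_apply (σ := σ) (φ := mulOp S ψ) hψ hg]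
    rfl
  constructor
  · rintro ⟨hψ, h⟩
    obtain ⟨g, hg⟩ := mem_sobolevH1_iff.1 (show mulOp S ψ ∈ sobolevH1 d n from hψ)
    exact ⟨g, hg, by rw [← key hψ g hg, h]⟩
  · rintro ⟨g, hg, h⟩
    have hψ : ψ ∈ (gappedOp σ S V₀).domain :=
      show mulOp S ψ ∈ sobolevH1 d n from mem_sobolevH1_iff.2 ⟨g, hg⟩
    exact ⟨hψ, by rw [key hψ g hg, h]⟩

theorem exists_norm_resolvent_le {H : Type*} [NormedAddCommGroup H] [InnerProductSpace ℂ H]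
    {T : H →ₗ.[ℂ] H} {I : Set ℝ} (hI : IsCompact I)
    (hT : ∀ E ∈ I, (E : ℂ) ∈ unboundedResolventSet T) :
    ∃ M : ℝ, 0 < M ∧ ∀ E ∈ I, ‖unboundedResolvent T (E : ℂ)‖ ≤ M := by
  -- the second resolvent equation shows that the norm is locally bounded
  have hloc : ∀ E ∈ I, ∀ E' ∈ I,
      |E' - E| < (2 * (‖unboundedResolvent T (E : ℂ)‖ + 1))⁻¹ →
      ‖unboundedResolvent T (E' : ℂ)‖ ≤ 2 * (‖unboundedResolvent T (E : ℂ)‖ + 1) := by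
    intro E hE E' hE' hlt
    set m := ‖unboundedResolvent T (E : ℂ)‖ with hm
    have hm0 : 0 ≤ m := norm_nonneg _
    refine ContinuousLinearMap.opNorm_le_bound _ (by positivity) fun f => ?_
    set g := unboundedResolvent T (E' : ℂ) f with hg
    obtain ⟨hgd, hgf⟩ := (isResolventAt_unboundedResolvent (hT E' hE') f g).1 rfl
    have h1 : unboundedResolvent T (E : ℂ) (f + ((E' : ℂ) - E) • g) = g := by
      rw [isResolventAt_unboundedResolvent (hT E hE)]
      refine ⟨hgd, ?_⟩
      rw [← hgf, sub_smul]
      abel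
    have h2 : ‖g‖ ≤ m * (‖f‖ + |E' - E| * ‖g‖) := by
      calc ‖g‖ = ‖unboundedResolvent T (E : ℂ) (f + ((E' : ℂ) - E) • g)‖ := by rw [h1]
        _ ≤ m * ‖f + ((E' : ℂ) - E) • g‖ := ContinuousLinearMap.le_opNorm _ _
        _ ≤ m * (‖f‖ + ‖((E' : ℂ) - E) • g‖) := by gcongr; exact norm_add_le _ _
        _ = _ := by rw [norm_smul, ← Complex.ofReal_sub, Complex.norm_real, Real.norm_eq_abs]
    have h3 : |E' - E| * (2 * (m + 1)) ≤ 1 := by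
      have := mul_le_mul_of_nonneg_right hlt.le (by positivity : 0 ≤ 2 * (m + 1))
      rwa [inv_mul_cancel₀ (by positivity)] at this
    nlinarith [norm_nonneg f, norm_nonneg g, mul_nonneg hm0 (norm_nonneg g),
      mul_le_mul_of_nonneg_right h3 (norm_nonneg g), abs_nonneg (E' - E),
      mul_nonneg (abs_nonneg (E' - E)) (norm_nonneg g)]
  have key : ∃ M : ℝ, 0 < M ∧ ∀ E ∈ I, E ∈ I → ‖unboundedResolvent T (E : ℂ)‖ ≤ M := by
    refine hI.induction_on (p := fun s => ∃ M : ℝ, 0 < M ∧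
      ∀ E ∈ s, E ∈ I → ‖unboundedResolvent T (E : ℂ)‖ ≤ M) ⟨1, one_pos, by simp⟩ ?_ ?_ ?_
    · rintro s t hst ⟨M, hM, h⟩
      exact ⟨M, hM, fun E hE => h E (hst hE)⟩
    · rintro s t ⟨M, hM, h⟩ ⟨M', hM', h'⟩
      refine ⟨max M M', lt_max_of_lt_left hM, fun E hE hEI => ?_⟩
      rcases hE with hE | hE
      · exact (h E hE hEI).trans (le_max_left _ _)
      · exact (h' E hE hEI).trans (le_max_right _ _)
    · intro E hE
      refine ⟨Metric.ball E (2 * (‖unboundedResolvent T (E : ℂ)‖ + 1))⁻¹,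
        mem_nhdsWithin_of_mem_nhds (Metric.ball_mem_nhds _ (by positivity)),
        2 * (‖unboundedResolvent T (E : ℂ)‖ + 1), by positivity, fun E' hE' hE'I => ?_⟩
      exact hloc E hE E' hE'I (by simpa [Real.dist_eq] using hE')
  obtain ⟨M, hM, h⟩ := key
  exact ⟨M, hM, fun E hE => h E hE hE⟩

/-! ### Decay of the resolvent -/

/-- The weight `(1 + δ² |x - a|²)^(-s)`. -/
noncomputable def decayWeight (δ : ℝ) (s : ℕ) (a x : Space d) : ℝ :=
  ((1 + ‖δ • (x - a)‖ ^ 2) ^ s)⁻¹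

theorem decayWeight_pos (δ : ℝ) (s : ℕ) (a x : Space d) : 0 < decayWeight δ s a x := by
  rw [decayWeight]; positivity

theorem decayWeight_le_one (δ : ℝ) (s : ℕ) (a x : Space d) : decayWeight δ s a x ≤ 1 :=
  inv_le_one_of_one_le₀ (one_le_pow₀ (by nlinarith [sq_nonneg ‖δ • (x - a)‖]))

theorem hasTemperateGrowth_decayWeight (δ : ℝ) (s : ℕ) (a : Space d) :
    (decayWeight δ s a).HasTemperateGrowth := by
  have h : decayWeight δ s a =
      (fun x : Space d => (1 + ‖x‖ ^ 2) ^ (-(s : ℝ))) ∘ fun x => δ • (x - a) := by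
    ext x
    rw [decayWeight, Function.comp_apply, Real.rpow_neg (by positivity), Real.rpow_natCast]
  rw [h]
  refine Function.HasTemperateGrowth.comp (by fun_prop) ?_
  exact (Function.HasTemperateGrowth.const δ).fun_smul
    (Function.HasTemperateGrowth.id'.fun_sub (Function.HasTemperateGrowth.const a))

theorem abs_fderiv_decayWeight_le {δ : ℝ} (hδ : 0 ≤ δ) (s : ℕ) (a x v : Space d) (hv : ‖v‖ = 1) :
    |fderiv ℝ (decayWeight δ s a) x v| ≤ s * δ * decayWeight δ s a x := by
  set y := 1 + ‖δ • (x - a)‖ ^ 2 with hy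
  have hy0 : 0 < y := by positivity
  have h1 : HasFDerivAt (fun x : Space d => δ • (x - a))
      (δ • ContinuousLinearMap.id ℝ (Space d)) x :=
    ((hasFDerivAt_id x).sub_const a).const_smul δ
  have h2 := (h1.norm_sq.const_add 1).pow s
  have h3 := (hasDerivAt_inv (x := y ^ s) (by positivity)).comp_hasFDerivAt x h2
  have h4 : HasFDerivAt (decayWeight δ s a) _ x := h3
  rw [h4.fderiv, decayWeight, ← hy]
  simp only [smul_apply, ContinuousLinearMap.comp_apply,
    ContinuousLinearMap.id_apply, innerSL_apply_apply, smul_eq_mul, nsmul_eq_mul, Nat.cast_ofNat,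
    real_inner_smul_right]
  have h5 : |inner ℝ (δ • (x - a)) v| ≤ ‖δ • (x - a)‖ := by
    simpa [hv] using abs_real_inner_le_norm (δ • (x - a)) v
  have h6 : 2 * ‖δ • (x - a)‖ ≤ y := by rw [hy]; nlinarith [sq_nonneg (‖δ • (x - a)‖ - 1)]
  rcases s with _ | m
  · simp
  set t := inner ℝ (δ • (x - a)) v
  have h7 : -((y ^ (m + 1)) ^ 2)⁻¹ * (((m + 1 : ℕ) : ℝ) * y ^ (m + 1 - 1) * (2 * (δ * t))) =
      -(((m + 1 : ℕ) : ℝ) * δ * (y ^ (m + 1))⁻¹ * (2 * t / y)) := by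
    rw [Nat.add_sub_cancel]
    field_simp
    ring
  rw [h7, abs_neg, abs_mul, abs_of_nonneg (by positivity)]
  refine mul_le_of_le_one_right (by positivity) ?_
  rw [abs_div, abs_of_pos hy0, div_le_one hy0, abs_mul, abs_two]
  linarith

theorem memLp_decayWeight (δ : ℝ) (s : ℕ) (a : Space d) :
    MemLp (decayWeight δ s a) ∞ volume :=
  memLp_top_of_bound (hasTemperateGrowth_decayWeight δ s a).1.continuous.aestronglyMeasurable 1
    (Eventually.of_forall fun x => by
      rw [Real.norm_of_nonneg (decayWeight_pos δ s a x).le]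
      exact decayWeight_le_one δ s a x)

theorem memLp_fderiv_decayWeight {δ : ℝ} (hδ : 0 ≤ δ) (s : ℕ) (a v : Space d) (hv : ‖v‖ = 1) :
    MemLp (fun x => fderiv ℝ (decayWeight δ s a) x v) ∞ volume := by
  have hc : Continuous fun x => fderiv ℝ (decayWeight δ s a) x v :=
    ((hasTemperateGrowth_decayWeight δ s a).1.continuous_fderiv (by simp)).clm_apply
      continuous_const
  refine memLp_top_of_bound hc.aestronglyMeasurable (s * δ) (Eventually.of_forall fun x => ?_)
  refine (abs_fderiv_decayWeight_le hδ s a x v hv).trans ?_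
  exact mul_le_of_le_one_right (by positivity) (decayWeight_le_one δ s a x)

/-- A Combes-Thomas estimate: the commutator of `H₀` with the slowly varying weight is bounded
by a small multiple of the weight itself, and can be absorbed. -/
theorem norm_decayWeight_resolvent_le {σ : Fin d → Mat n} {S V₀ : LinftyMat d n} {z : ℂ}
    {R : L2 d n →L[ℂ] L2 d n} (hR : IsResolventAt (gappedOp σ S V₀) z R) {b : ℝ} (hb : ‖R‖ ≤ b)
    {δ : ℝ} (hδ : 0 ≤ δ) {s : ℕ}
    (hsmall : b * (‖mulOp S‖ * ((∑ j, ‖constMulOp d (σ j)‖) * (s * δ) * ‖mulOp S‖)) ≤ 1 / 2)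
    (a : Space d) (f : L2 d n) :
    ‖scalarOp n _ (memLp_decayWeight δ s a) (R f)‖ ≤
      2 * b * ‖scalarOp n _ (memLp_decayWeight δ s a) f‖ := by
  have hb0 : 0 ≤ b := (norm_nonneg _).trans hb
  set W := scalarOp n _ (memLp_decayWeight δ s a) with hW
  set ψ := R f with hψ
  obtain ⟨g, hg, hgf⟩ := (hR.apply_eq_iff f ψ).1 rfl
  have he : ∀ j : Fin d, ‖EuclideanSpace.single j (1 : ℝ)‖ = 1 := fun j => by simp
  set W' : Fin d → L2 d n →L[ℂ] L2 d n := fun j =>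
    scalarOp n _ (memLp_fderiv_decayWeight hδ s a _ (he j)) with hW'
  set r : L2 d n := diracOp σ fun j => W' j (mulOp S ψ) with hr
  have h1 : R (W f + mulOp S r) = W ψ := by
    rw [hR.apply_eq_iff]
    refine ⟨fun j => W (g j) + W' j (mulOp S ψ), fun j => ?_, ?_⟩
    · rw [hW, mulOp_scalarOp]
      exact (hg j).leibniz (hasTemperateGrowth_decayWeight δ s a) _ _ fun x => rfl
    · have h2 : diracOp σ (fun j => W (g j) + W' j (mulOp S ψ)) = W (diracOp σ g) + r := by
        simp only [hr, diracOp, map_sum, ← Finset.sum_add_distrib]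
        refine Finset.sum_congr rfl fun j _ => ?_
        rw [map_add, smul_add, hW, constMulOp_scalarOp, map_smul]
      rw [h2, map_add, hW, mulOp_scalarOp, mulOp_scalarOp, ← hgf, map_sub, map_add, map_smul]
      abel
  have h3 : ‖r‖ ≤ (∑ j, ‖constMulOp d (σ j)‖) * (s * δ) * ‖mulOp S‖ * ‖W ψ‖ := by
    have h4 : ‖W (mulOp S ψ)‖ ≤ ‖mulOp S‖ * ‖W ψ‖ := by
      rw [hW, ← mulOp_scalarOp]
      exact ContinuousLinearMap.le_opNorm _ _
    have h5 : ∀ j, ‖W' j (mulOp S ψ)‖ ≤ s * δ * ‖W (mulOp S ψ)‖ := fun j =>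
      norm_scalarOp_apply_le _ _ (fun x => by
        rw [abs_of_pos (decayWeight_pos δ s a x)]
        exact abs_fderiv_decayWeight_le hδ s a x _ (he j)) _
    calc ‖r‖ ≤ ∑ j, ‖(-Complex.I) • constMulOp d (σ j) (W' j (mulOp S ψ))‖ := norm_sum_le _ _
      _ ≤ ∑ j, ‖constMulOp d (σ j)‖ * (s * δ * (‖mulOp S‖ * ‖W ψ‖)) := by
          refine Finset.sum_le_sum fun j _ => ?_
          rw [norm_smul, norm_neg, Complex.norm_I, one_mul]
          refine (ContinuousLinearMap.le_opNorm _ _).trans ?_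
          gcongr
          exact (h5 j).trans (by gcongr)
      _ = _ := by rw [← Finset.sum_mul]; ring
  have h6 : ‖W ψ‖ ≤ b * ‖W f‖ + b * (‖mulOp S‖ * ((∑ j, ‖constMulOp d (σ j)‖) * (s * δ) *
      ‖mulOp S‖)) * ‖W ψ‖ := by
    calc ‖W ψ‖ = ‖R (W f + mulOp S r)‖ := by rw [h1]
      _ ≤ b * ‖W f + mulOp S r‖ := R.le_of_opNorm_le hb _
      _ ≤ b * (‖W f‖ + ‖mulOp S‖ * ((∑ j, ‖constMulOp d (σ j)‖) * (s * δ) * ‖mulOp S‖ *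
            ‖W ψ‖)) := by
          gcongr
          refine (norm_add_le _ _).trans ?_
          gcongr
          exact ((mulOp S).le_opNorm r).trans (by gcongr)
      _ = _ := by ring
  nlinarith [mul_le_mul_of_nonneg_right hsmall (norm_nonneg (W ψ))]

/-- The cube of side `6` around a lattice point. It contains the support of the corresponding
single-site potential. -/
def siteCube (k : Fin d → ℤ) : Set (Space d) := {y | ∀ j, (k j : ℝ) - 3 ≤ y j ∧ y j < k j + 3}

theorem measurableSet_siteCube (k : Fin d → ℤ) : MeasurableSet (siteCube k) := by
  simp only [siteCube, Set.ofPred_forall]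
  refine MeasurableSet.iInter fun j => ?_
  have hm : Measurable fun y : Space d => y j := by fun_prop
  exact (measurableSet_le measurable_const hm).inter (measurableSet_lt hm measurable_const)

theorem memLp_siteCube (k : Fin d → ℤ) :
    MemLp ((siteCube k).indicator fun _ => (1 : ℝ)) ∞ volume :=
  (memLp_top_const (1 : ℝ)).indicator (measurableSet_siteCube k)

theorem norm_sub_latticePoint_sq_le {k : Fin d → ℤ} {y : Space d} (hy : y ∈ siteCube k) :
    ‖y - latticePoint k‖ ^ 2 ≤ 9 * d := by
  rw [EuclideanSpace.norm_sq_eq]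
  calc ∑ j, ‖(y - latticePoint k) j‖ ^ 2 ≤ ∑ _j : Fin d, (9 : ℝ) := by
        refine Finset.sum_le_sum fun j _ => ?_
        have h : (y - latticePoint k) j = y j - k j := by simp [latticePoint]
        rw [h, Real.norm_eq_abs, sq_abs]
        nlinarith [(hy j).1, (hy j).2]
    _ = _ := by simp [mul_comm]

/-- Multiplication by the indicator function of `siteCube k`. -/
noncomputable def cutoff (n : ℕ) (k : Fin d → ℤ) : L2 d n →L[ℂ] L2 d n :=
  scalarOp n _ (memLp_siteCube k)

/-- An operator that is bounded with respect to the weights around all points decays off the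
diagonal: the weight around `i` is of order one on the cube of `i`, and small on the cube of `k`. -/
theorem norm_cutoff_mul_mul_cutoff_le {δ : ℝ} {s : ℕ} {T : L2 d n →L[ℂ] L2 d n} {B : ℝ}
    (hB : 0 ≤ B)
    (hT : ∀ a f, ‖scalarOp n _ (memLp_decayWeight δ s a) (T f)‖ ≤
      B * ‖scalarOp n _ (memLp_decayWeight δ s a) f‖) (i k : Fin d → ℤ) :
    ‖cutoff n i * T * cutoff n k‖ ≤
      (2 * (1 + δ ^ 2 * (9 * d)) ^ 2) ^ s * B *
        decayWeight δ s (latticePoint k) (latticePoint i) := by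
  set Γ : ℝ := 1 + δ ^ 2 * (9 * d) with hΓ
  have hΓ0 : 0 < Γ := by positivity
  set a := latticePoint i with ha
  have hcube : ∀ (l : Fin d → ℤ) x, x ∈ siteCube l → 1 + ‖δ • (x - latticePoint l)‖ ^ 2 ≤ Γ :=
    fun l x hx => by
      rw [norm_smul, mul_pow, Real.norm_eq_abs, sq_abs, hΓ]
      gcongr
      exact norm_sub_latticePoint_sq_le hx
  set ρ := decayWeight δ s (latticePoint k) a with hρ
  have hρ0 : 0 < ρ := decayWeight_pos _ _ _ _
  set W := scalarOp n _ (memLp_decayWeight δ s a) with hW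
  have h1 : ∀ ψ : L2 d n, ‖cutoff n i ψ‖ ≤ Γ ^ s * ‖W ψ‖ := fun ψ => by
    refine norm_scalarOp_apply_le _ _ (fun x => ?_) ψ
    rw [abs_of_pos (decayWeight_pos δ s a x)]
    by_cases hx : x ∈ siteCube i
    · rw [Set.indicator_of_mem hx, abs_one, decayWeight, ← div_eq_mul_inv,
        one_le_div (by positivity)]
      gcongr
      exact hcube i x hx
    · rw [Set.indicator_of_notMem hx, abs_zero]
      exact mul_nonneg (by positivity) (decayWeight_pos _ _ _ _).le
  have h2 : ∀ f : L2 d n, ‖W (cutoff n k f)‖ ≤ (2 * Γ) ^ s * ρ * ‖f‖ := fun f => by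
    refine norm_le_of_ae_norm_le ?_
    filter_upwards [scalarOp_apply_ae (memLp_decayWeight δ s a) (cutoff n k f),
      scalarOp_apply_ae (memLp_siteCube k) f] with x e1 e2
    rw [hW, e1, cutoff, e2, norm_smul, Complex.norm_real,
      Real.norm_of_nonneg (decayWeight_pos δ s a x).le]
    by_cases hx : x ∈ siteCube k
    · rw [Set.indicator_of_mem hx, Complex.ofReal_one, one_smul]
      gcongr
      rw [hρ, decayWeight, decayWeight, ← div_eq_mul_inv, le_div_iff₀ (by positivity),
        inv_mul_le_iff₀ (by positivity), ← mul_pow]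
      -- Peetre's inequality
      have h3 : ‖δ • (a - latticePoint k)‖ ≤ ‖δ • (x - a)‖ + ‖δ • (x - latticePoint k)‖ := by
        have : δ • (a - latticePoint k) = δ • (x - latticePoint k) - δ • (x - a) := by
          rw [← smul_sub]; congr 1; abel
        rw [this, add_comm]
        exact norm_sub_le _ _
      have h4 := hcube k x hx
      gcongr
      have h5 := norm_nonneg (δ • (a - latticePoint k))
      calc 1 + ‖δ • (a - latticePoint k)‖ ^ 2
          ≤ 1 + (‖δ • (x - a)‖ + ‖δ • (x - latticePoint k)‖) ^ 2 := by gcongr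
        _ ≤ (1 + ‖δ • (x - a)‖ ^ 2) * (2 * (1 + ‖δ • (x - latticePoint k)‖ ^ 2)) := by
            nlinarith [sq_nonneg (‖δ • (x - a)‖ - ‖δ • (x - latticePoint k)‖),
              sq_nonneg (‖δ • (x - a)‖ * ‖δ • (x - latticePoint k)‖)]
        _ ≤ _ := by gcongr
    · rw [Set.indicator_of_notMem hx, Complex.ofReal_zero, zero_smul, norm_zero, mul_zero]
      positivity
  refine ContinuousLinearMap.opNorm_le_bound _ (by positivity) fun f => ?_
  calc ‖cutoff n i (T (cutoff n k f))‖ ≤ Γ ^ s * ‖W (T (cutoff n k f))‖ := h1 _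
    _ ≤ Γ ^ s * (B * ‖W (cutoff n k f)‖) := by gcongr; exact hT a _
    _ ≤ Γ ^ s * (B * ((2 * Γ) ^ s * ρ * ‖f‖)) := by gcongr; exact h2 f
    _ = (Γ * (2 * Γ)) ^ s * B * ρ * ‖f‖ := by rw [mul_pow Γ (2 * Γ)]; ring
    _ = _ := by rw [show Γ * (2 * Γ) = 2 * Γ ^ 2 by ring]

/-! ### Fourier transform and translations -/

theorem ae_eq_of_schwartz_integral_eq {F : Type*} [NormedAddCommGroup F] [NormedSpace ℂ F]
    [CompleteSpace F] {f g : Space d → F} (hf : LocallyIntegrable f) (hg : LocallyIntegrable g)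
    (h : ∀ η : 𝓢(Space d, ℂ), ∫ x, η x • f x = ∫ x, η x • g x) : f =ᵐ[volume] g := by
  refine ae_eq_of_integral_contDiff_smul_eq hf hg fun η hη hc => ?_
  have hc' : HasCompactSupport (Complex.ofRealCLM ∘ η) := hc.comp_left rfl
  have hη' : ContDiff ℝ ∞ (Complex.ofRealCLM ∘ η) := by fun_prop
  have := h (hc'.toSchwartzMap hη')
  simpa using this

theorem integral_schwartz_smul_fourier (f : L2 d n) (η : 𝓢(Space d, ℂ)) :
    ∫ x, η x • (𝓕 f : L2 d n) x = ∫ x, (𝓕 η) x • f x := by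
  have h := congrArg (fun T : 𝓢'(Space d, Spinor n) => T η)
    (Lp.fourier_toTemperedDistribution_eq f)
  simp only [TemperedDistribution.fourier_apply, Lp.toTemperedDistribution_apply] at h
  exact h.symm

theorem HasWeakPartial.fourier_ae {j : Fin d} {φ g : L2 d n} (h : HasWeakPartial j φ g) :
    (𝓕 g : L2 d n) =ᵐ[volume]
      fun p => (2 * Real.pi * Complex.I * (p j : ℂ)) • (𝓕 φ : L2 d n) p := by
  have hloc : LocallyIntegrable (𝓕 φ : L2 d n) volume :=
    (Lp.memLp _).locallyIntegrable one_le_two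
  have hcont : Continuous fun p : Space d => 2 * Real.pi * Complex.I * (p j : ℂ) := by fun_prop
  refine ae_eq_of_schwartz_integral_eq ((Lp.memLp _).locallyIntegrable one_le_two)
    (hloc.continuous_smul hcont) fun η => ?_
  have h1 : 𝓕 (∂_{EuclideanSpace.single j (1 : ℝ)} (φ : 𝓢'(Space d, Spinor n))) =
      𝓕 (g : 𝓢'(Space d, Spinor n)) := by rw [h]
  rw [TemperedDistribution.fourier_lineDerivOp_eq, Lp.fourier_toTemperedDistribution_eq,
    Lp.fourier_toTemperedDistribution_eq] at h1
  have h2 := congrArg (fun T : 𝓢'(Space d, Spinor n) => T η) h1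
  have ht : (fun x : Space d =>
      ((inner ℝ x (EuclideanSpace.single j (1 : ℝ)) : ℝ) : ℂ)).HasTemperateGrowth := by
    fun_prop
  simp only [smul_apply, TemperedDistribution.smulLeftCLM_apply_apply,
    Lp.toTemperedDistribution_apply] at h2
  rw [← h2, ← integral_smul]
  refine integral_congr_ae (Eventually.of_forall fun p => ?_)
  simp only
  rw [SchwartzMap.smulLeftCLM_apply_apply ht, EuclideanSpace.inner_single_right]
  simp only [smul_smul, smul_eq_mul]
  congr 1
  simp
  ring

theorem fourier_constMulOp (A : Mat n) (f : L2 d n) :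
    (𝓕 (constMulOp d A f) : L2 d n) = constMulOp d A (𝓕 f) := by
  refine Lp.ext (ae_eq_of_schwartz_integral_eq ((Lp.memLp _).locallyIntegrable one_le_two)
    ((Lp.memLp _).locallyIntegrable one_le_two) fun η => ?_)
  have key : ∀ (θ : 𝓢(Space d, ℂ)) (v : L2 d n), ∫ x, θ x • (constMulOp d A v) x =
      Matrix.toEuclideanCLM (n := Fin n) (𝕜 := ℂ) A (∫ x, θ x • v x) := fun θ v => by
    rw [← ContinuousLinearMap.integral_comp_comm _ (integrable_schwartz_smul v θ)]
    refine integral_congr_ae ?_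
    filter_upwards [constMulOp_apply_ae A v] with x hx
    rw [hx, map_smul]
  rw [integral_schwartz_smul_fourier, key, key, integral_schwartz_smul_fourier]

/-- Translation `f ↦ f (· + h)` on `L²`. -/
noncomputable def translation (n : ℕ) (h : Space d) : L2 d n →ₗᵢ[ℂ] L2 d n :=
  Lp.compMeasurePreservingₗᵢ ℂ (fun x => x + h) (measurePreserving_add_right volume h)

theorem translation_apply_ae (h : Space d) (f : L2 d n) :
    translation n h f =ᵐ[volume] fun x => f (x + h) :=
  Lp.coeFn_compMeasurePreserving f (measurePreserving_add_right volume h)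

theorem fourier_translation_ae (h : Space d) (f : L2 d n) :
    (𝓕 (translation n h f) : L2 d n) =ᵐ[volume]
      fun p => ((Real.fourierChar (inner ℝ h p) : Circle) : ℂ) • (𝓕 f : L2 d n) p := by
  set e : Space d → ℂ := fun p => ((Real.fourierChar (inner ℝ h p) : Circle) : ℂ) with he
  have hec : Continuous e := by
    have := Real.continuous_fourierChar
    fun_prop
  have heA : MemLp (fun p => e p • (1 : Mat n)) ∞ volume :=
    memLp_top_of_bound (by fun_prop) ‖(1 : Mat n)‖ (Eventually.of_forall fun p => by
      rw [norm_smul, Circle.norm_coe, one_mul])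
  have hP : ∀ g : L2 d n, mulOp (heA.toLp _) g =ᵐ[volume] fun p => e p • g p := fun g => by
    filter_upwards [mulOp_apply_ae (heA.toLp _) g, heA.coeFn_toLp] with p h1 h2
    rw [h1, h2]
    simp [Matrix.smul_mulVec]
  suffices hs : ∀ f : L2 d n, (𝓕 (translation n h f) : L2 d n) = mulOp (heA.toLp _) (𝓕 f) by
    rw [hs f]; exact hP _
  intro f
  refine DenseRange.induction_on
    (p := fun f : L2 d n => (𝓕 (translation n h f) : L2 d n) = mulOp (heA.toLp _) (𝓕 f))
    (SchwartzMap.denseRange_toLpCLM (F := Spinor n) (E := Space d) (μ := volume)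
      (p := 2) ENNReal.ofNat_ne_top) f ?_ ?_
  · refine isClosed_eq ?_ ?_
    · exact (fourierCLM ℂ (L2 d n)).continuous.comp (translation n h).continuous
    · exact (mulOp _).continuous.comp (fourierCLM ℂ (L2 d n)).continuous
  · intro η
    set η' : 𝓢(Space d, Spinor n) := η.compSubConstCLM ℂ (-h) with hη'
    have h1 : translation n h (SchwartzMap.toLpCLM ℝ (Spinor n) 2 volume η) = η'.toLp 2 volume := by
      refine Lp.ext ?_
      have h2 := (measurePreserving_add_right volume h).quasiMeasurePreserving.ae_eq_comp
        (η.coeFn_toLp 2 volume)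
      filter_upwards [translation_apply_ae h (SchwartzMap.toLpCLM ℝ (Spinor n) 2 volume η), h2,
        η'.coeFn_toLp 2 volume] with x h3 h4 h5
      rw [h3, h5, hη', SchwartzMap.compSubConstCLM_apply, sub_neg_eq_add]
      exact h4
    rw [h1, SchwartzMap.toLpCLM_apply, SchwartzMap.toLp_fourier_eq, SchwartzMap.toLp_fourier_eq]
    refine Lp.ext ?_
    filter_upwards [hP ((𝓕 η).toLp 2 volume), (𝓕 η).coeFn_toLp 2 volume,
      (𝓕 η').coeFn_toLp 2 volume] with p h3 h4 h5
    rw [h3, h4, h5, SchwartzMap.fourier_coe, SchwartzMap.fourier_coe]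
    have h6 : (η' : Space d → Spinor n) = η ∘ fun x => x + h := by
      ext1 x
      rw [hη', SchwartzMap.compSubConstCLM_apply, sub_neg_eq_add, Function.comp_apply]
    rw [h6]
    have := congrFun (VectorFourier.fourierIntegral_comp_add_right Real.fourierChar volume
      (innerₗ (Space d)) (η : Space d → Spinor n) h) p
    exact this

theorem norm_fourierChar_sub_one_le (t : ℝ) :
    ‖((Real.fourierChar t : Circle) : ℂ) - 1‖ ≤ 2 * Real.pi * |t| := by
  rw [Real.fourierChar_apply]
  have := Real.norm_exp_I_mul_ofReal_sub_one_le (x := 2 * Real.pi * t)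
  rw [mul_comm Complex.I] at this
  refine this.trans_eq ?_
  rw [Real.norm_eq_abs, abs_mul, abs_of_pos Real.two_pi_pos]

/-- By Plancherel and ellipticity, the translates of `φ ∈ H¹` differ from `φ` by at most
`|h| ‖D₀ φ‖`, up to a constant. -/
theorem norm_translation_sub_le {σ : Fin d → Mat n} {c : ℝ} (hc : 0 < c)
    (hσ : ∀ (p : Space d) (v : Spinor n), c * ‖p‖ * ‖v‖ ≤
      ‖Matrix.toEuclideanCLM (n := Fin n) (𝕜 := ℂ) (∑ j, (p j : ℂ) • σ j) v‖)
    {φ : L2 d n} {g : Fin d → L2 d n} (hg : ∀ j, HasWeakPartial j φ (g j)) (h : Space d) :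
    ‖translation n h φ - φ‖ ≤ c⁻¹ * ‖h‖ * ‖diracOp σ g‖ := by
  have h1 : (𝓕 (diracOp σ g) : L2 d n) = diracOp σ fun j => 𝓕 (g j) := by
    change fourierCLM ℂ (L2 d n) (diracOp σ g) = _
    simp only [diracOp, map_sum, map_smul]
    refine Finset.sum_congr rfl fun j _ => ?_
    congr 1
    exact fourier_constMulOp _ _
  have h2 : ∀ᵐ p, (𝓕 (diracOp σ g) : L2 d n) p = (2 * Real.pi : ℂ) •
      Matrix.toEuclideanCLM (n := Fin n) (𝕜 := ℂ) (∑ j, (p j : ℂ) • σ j) ((𝓕 φ : L2 d n) p) := by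
    rw [h1, diracOp]
    have e1 := Lp.coeFn_finsetSum (Finset.univ : Finset (Fin d))
      (fun j => (-Complex.I) • constMulOp d (σ j) (𝓕 (g j)))
    have e2 : ∀ᵐ p, ∀ j, ((-Complex.I) • constMulOp d (σ j) (𝓕 (g j)) : L2 d n) p =
        (-Complex.I) • (constMulOp d (σ j) (𝓕 (g j)) : L2 d n) p :=
      ae_all_iff.2 fun j => Lp.coeFn_smul _ _
    have e3 := ae_all_iff.2 fun j => constMulOp_apply_ae (σ j) (𝓕 (g j) : L2 d n)
    have e4 := ae_all_iff.2 fun j => (hg j).fourier_ae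
    filter_upwards [e1, e2, e3, e4] with p e1 e2 e3 e4
    rw [e1]
    simp only [Finset.sum_apply, map_sum, map_smul, sum_apply, smul_apply,
      Finset.smul_sum]
    refine Finset.sum_congr rfl fun j _ => ?_
    rw [e2, e3, e4, map_smul, smul_smul, smul_smul]
    congr 1
    linear_combination (-2 * Real.pi * (p j : ℂ)) * Complex.I_sq
  rw [← Lp.norm_fourier_eq, ← Lp.norm_fourier_eq (diracOp σ g)]
  refine norm_le_of_ae_norm_le ?_
  have h3 : (𝓕 (translation n h φ - φ) : L2 d n) = 𝓕 (translation n h φ) - 𝓕 φ :=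
    map_sub (fourierCLM ℂ (L2 d n)) _ _
  rw [h3]
  filter_upwards [h2, fourier_translation_ae h φ,
    Lp.coeFn_sub (𝓕 (translation n h φ) : L2 d n) (𝓕 φ)] with p e1 e2 e3
  rw [e3, Pi.sub_apply, e2, e1]
  set v := (𝓕 φ : L2 d n) p
  rw [show ∀ z : ℂ, z • v - v = (z - 1) • v from fun z => by rw [sub_smul, one_smul], norm_smul,
    norm_smul]
  have h4 : ‖(2 * Real.pi : ℂ)‖ = 2 * Real.pi := by
    rw [← Complex.ofReal_ofNat, ← Complex.ofReal_mul, Complex.norm_real,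
      Real.norm_of_nonneg Real.two_pi_pos.le]
  rw [h4]
  calc _ ≤ 2 * Real.pi * |inner ℝ h p| * ‖v‖ := by
        gcongr; exact norm_fourierChar_sub_one_le _
    _ ≤ 2 * Real.pi * (‖h‖ * ‖p‖) * ‖v‖ := by
        gcongr; exact abs_real_inner_le_norm h p
    _ = c⁻¹ * ‖h‖ * (2 * Real.pi * (c * ‖p‖ * ‖v‖)) := by field_simp
    _ ≤ _ := by
        gcongr
        exact hσ p v

/-! ### A Poincaré inequality on small cubes -/

theorem lintegral_enorm_sq (f : L2 d n) : ∫⁻ x, ‖f x‖ₑ ^ 2 = ‖f‖ₑ ^ 2 := by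
  rw [Lp.enorm_def, eLpNorm_eq_lintegral_rpow_enorm_toReal (by norm_num) (by norm_num),
    ← ENNReal.rpow_natCast _ 2, ← ENNReal.rpow_mul]
  simp

/-- The cube of side `1 / N` with lower corner `k / N`. -/
def gridCube (N : ℕ) (k : Fin d → ℤ) : Set (Space d) :=
  {y | ∀ j, (k j : ℝ) ≤ N * y j ∧ N * y j < k j + 1}

theorem gridCube_eq_preimage {N : ℕ} (hN : 0 < N) (k : Fin d → ℤ) : gridCube N k =
    WithLp.ofLp ⁻¹' (Set.univ.pi fun j => Set.Ico ((k j : ℝ) / N) ((k j + 1) / N)) := by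
  ext y
  have hN' : (0 : ℝ) < N := by exact_mod_cast hN
  simp only [gridCube, Set.mem_ofPred_eq, Set.mem_preimage, Set.mem_univ_pi, Set.mem_Ico]
  refine forall_congr' fun j => ?_
  rw [div_le_iff₀' hN', lt_div_iff₀' hN']

theorem measurableSet_gridCube {N : ℕ} (hN : 0 < N) (k : Fin d → ℤ) :
    MeasurableSet (gridCube N k) := by
  rw [gridCube_eq_preimage hN]
  exact (PiLp.volume_preserving_ofLp (Fin d)).measurable
    (MeasurableSet.univ_pi fun _ => measurableSet_Ico)

theorem volume_gridCube {N : ℕ} (hN : 0 < N) (k : Fin d → ℤ) :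
    volume (gridCube N k) = ENNReal.ofReal (1 / N) ^ d := by
  rw [gridCube_eq_preimage hN, (PiLp.volume_preserving_ofLp (Fin d)).measure_preimage
    (MeasurableSet.univ_pi fun _ => measurableSet_Ico).nullMeasurableSet, Real.volume_pi_Ico]
  simp [← sub_div]

/-- The cube of side `2 / N` centred at the origin, which contains all the differences of points of
a cube of side `1 / N`. -/
def differenceCube (d N : ℕ) : Set (Space d) := {h | ∀ j, |N * h j| < 1}

theorem differenceCube_eq_preimage {N : ℕ} (hN : 0 < N) : differenceCube d N =
    WithLp.ofLp ⁻¹' (Set.univ.pi fun _ => Set.Ioo (-(1 : ℝ) / N) (1 / N)) := by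
  ext y
  have hN' : (0 : ℝ) < N := by exact_mod_cast hN
  simp only [differenceCube, Set.mem_ofPred_eq, Set.mem_preimage, Set.mem_univ_pi, Set.mem_Ioo]
  refine forall_congr' fun j => ?_
  rw [div_lt_iff₀' hN', lt_div_iff₀' hN', abs_lt]

theorem measurableSet_differenceCube {N : ℕ} (hN : 0 < N) :
    MeasurableSet (differenceCube d N) := by
  rw [differenceCube_eq_preimage hN]
  exact (PiLp.volume_preserving_ofLp (Fin d)).measurable
    (MeasurableSet.univ_pi fun _ => measurableSet_Ioo)

theorem volume_differenceCube {N : ℕ} (hN : 0 < N) :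
    volume (differenceCube d N) = 2 ^ d * ENNReal.ofReal (1 / N) ^ d := by
  rw [differenceCube_eq_preimage hN, (PiLp.volume_preserving_ofLp (Fin d)).measure_preimage
    (MeasurableSet.univ_pi fun _ => measurableSet_Ioo).nullMeasurableSet, Real.volume_pi_Ioo,
    ← mul_pow]
  have : (1 : ℝ) / N - -1 / N = 2 * (1 / N) := by ring
  simp only [this]
  rw [ENNReal.ofReal_mul (by norm_num)]
  simp

theorem norm_le_of_mem_differenceCube {N : ℕ} (hN : 0 < N) {h : Space d}
    (hh : h ∈ differenceCube d N) : ‖h‖ ≤ d / N := by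
  have hN' : (0 : ℝ) < N := by exact_mod_cast hN
  rw [← sq_le_sq₀ (norm_nonneg _) (by positivity), EuclideanSpace.norm_sq_eq]
  calc ∑ j, ‖h j‖ ^ 2 ≤ ∑ _j : Fin d, (1 / (N : ℝ)) ^ 2 := by
        refine Finset.sum_le_sum fun j _ => ?_
        have := hh j
        rw [abs_mul, Nat.abs_cast] at this
        gcongr
        rw [le_div_iff₀' hN', Real.norm_eq_abs]
        exact this.le
    _ = d * (1 / (N : ℝ)) ^ 2 := by simp
    _ ≤ (d : ℝ) ^ 2 * (1 / (N : ℝ)) ^ 2 := by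
        gcongr
        exact_mod_cast Nat.le_self_pow two_ne_zero d
    _ = _ := by ring

theorem sub_mem_differenceCube {N : ℕ} {k : Fin d → ℤ} {x y : Space d}
    (hx : x ∈ gridCube N k) (hy : y ∈ gridCube N k) : y - x ∈ differenceCube d N := fun j => by
  have h1 := hx j
  have h2 := hy j
  have : (y - x) j = y j - x j := rfl
  rw [this, mul_sub, abs_lt]
  constructor <;> linarith [h1.1, h1.2, h2.1, h2.2]

theorem lintegral_sq_le_lintegral_sq_mul {α : Type*} [MeasurableSpace α] (μ : Measure α)
    {f : α → ℝ≥0∞} (hf : AEMeasurable f μ) :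
    (∫⁻ x, f x ∂μ) ^ 2 ≤ (∫⁻ x, f x ^ 2 ∂μ) * μ Set.univ := by
  have h := ENNReal.lintegral_mul_le_Lp_mul_Lq μ Real.HolderConjugate.two_two hf
    (aemeasurable_const (b := (1 : ℝ≥0∞)))
  simp only [Pi.mul_apply, mul_one, lintegral_const, ENNReal.rpow_ofNat, one_pow,
    one_mul] at h
  calc (∫⁻ x, f x ∂μ) ^ 2 ≤ ((∫⁻ x, f x ^ 2 ∂μ) ^ (1 / 2 : ℝ) * μ Set.univ ^ (1 / 2 : ℝ)) ^ 2 := by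
        gcongr
    _ = _ := by
        rw [mul_pow, ← ENNReal.rpow_natCast, ← ENNReal.rpow_natCast, ← ENNReal.rpow_mul,
          ← ENNReal.rpow_mul]
        norm_num

/-- If `f` has mean zero on a cube, its values there are controlled by its differences. -/
theorem volume_mul_enorm_sq_le {f : L2 d n} {N : ℕ} (hN : 0 < N) {k : Fin d → ℤ}
    (hmean : ∫ y in gridCube N k, f y = 0) {x : Space d} (hx : x ∈ gridCube N k) :
    ENNReal.ofReal (1 / N) ^ d * ‖f x‖ₑ ^ 2 ≤
      ∫⁻ h in differenceCube d N, ‖f (x + h) - f x‖ₑ ^ 2 := by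
  set Q := gridCube N k with hQ
  set v := ENNReal.ofReal (1 / N) ^ d with hv
  have hvol : volume Q = v := volume_gridCube hN k
  have hv0 : v ≠ 0 := by
    rw [hv]
    exact pow_ne_zero _ (ENNReal.ofReal_pos.2 (by positivity)).ne'
  have hvt : v ≠ ⊤ := ENNReal.pow_ne_top ENNReal.ofReal_ne_top
  have hfin : IsFiniteMeasure (volume.restrict Q) := ⟨by
    rw [Measure.restrict_apply_univ, hvol]; exact hvt.lt_top⟩
  have hint : Integrable f (volume.restrict Q) :=
    ((Lp.memLp f).restrict Q).integrable one_le_two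
  have h1 : ∫ y in Q, (f y - f x) = -(volume.real Q • f x) := by
    rw [integral_sub hint (integrable_const _), hmean, zero_sub, setIntegral_const]
  have h2 : v * ‖f x‖ₑ ≤ ∫⁻ y in Q, ‖f y - f x‖ₑ := by
    have := enorm_integral_le_lintegral_enorm (μ := volume.restrict Q) (fun y => f y - f x)
    rw [h1, enorm_neg, enorm_smul, Measure.real, Real.enorm_of_nonneg ENNReal.toReal_nonneg,
      ENNReal.ofReal_toReal (hvol ▸ hvt), hvol] at this
    exact this
  have hfm : Measurable f := (Lp.stronglyMeasurable f).measurable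
  have h3 : (v * ‖f x‖ₑ) ^ 2 ≤ (∫⁻ y in Q, ‖f y - f x‖ₑ ^ 2) * v := by
    refine (pow_le_pow_left' h2 2).trans ((lintegral_sq_le_lintegral_sq_mul _ ?_).trans_eq ?_)
    · exact (hfm.sub_const _).enorm.aemeasurable
    · rw [Measure.restrict_apply_univ, hvol]
  have h4 : v * ‖f x‖ₑ ^ 2 ≤ ∫⁻ y in Q, ‖f y - f x‖ₑ ^ 2 := by
    rw [← ENNReal.mul_le_mul_iff_left hv0 hvt]
    refine le_trans (le_of_eq ?_) h3
    ring
  refine h4.trans ?_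
  rw [← lintegral_indicator (measurableSet_gridCube hN k),
    ← lintegral_indicator (measurableSet_differenceCube hN), ← lintegral_add_left_eq_self _ x]
  refine lintegral_mono fun h => ?_
  by_cases hh : x + h ∈ Q
  · have : h ∈ differenceCube d N := by
      simpa using sub_mem_differenceCube hx hh
    rw [Set.indicator_of_mem hh, Set.indicator_of_mem this]
  · rw [Set.indicator_of_notMem hh]
    exact zero_le

/-- A Poincaré inequality: if `f` has mean zero on all the cubes of side `1 / N` in `siteCube i`
and its translates are Lipschitz, then it is of size `O(1 / N)` there. -/
theorem norm_cutoff_le {f : L2 d n} {N : ℕ} (hN : 0 < N) {K : ℝ} (hK : 0 ≤ K)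
    (htr : ∀ h, ‖translation n h f - f‖ ≤ K * ‖h‖) {i : Fin d → ℤ}
    (hmean : ∀ m : Fin d → Fin (6 * N),
      ∫ y in gridCube N (fun j => N * (i j - 3) + (m j : ℕ)), f y = 0) :
    ‖cutoff n i f‖ ≤ 2 ^ d * d * K / N := by
  have hN' : (0 : ℝ) < N := by exact_mod_cast hN
  set v := ENNReal.ofReal (1 / N) ^ d with hv
  have hv0 : v ≠ 0 := by
    rw [hv]
    exact pow_ne_zero _ (ENNReal.ofReal_pos.2 (by positivity)).ne'
  have hvt : v ≠ ⊤ := ENNReal.pow_ne_top ENNReal.ofReal_ne_top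
  have hfm : Measurable f := (Lp.stronglyMeasurable f).measurable
  have hx : ∀ x, v * ‖(siteCube i).indicator f x‖ₑ ^ 2 ≤
      ∫⁻ h in differenceCube d N, ‖f (x + h) - f x‖ₑ ^ 2 := fun x => by
    by_cases hxi : x ∈ siteCube i
    · rw [Set.indicator_of_mem hxi]
      have hfloor : ∀ j, 0 ≤ ⌊N * x j⌋ - N * (i j - 3) ∧
          ⌊N * x j⌋ - N * (i j - 3) < (6 * N : ℕ) := fun j => by
        have h1 : ((N * (i j - 3) : ℤ) : ℝ) ≤ N * x j := by
          push_cast; exact mul_le_mul_of_nonneg_left (hxi j).1 hN'.le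
        have h2 : N * x j < ((N * (i j + 3) : ℤ) : ℝ) := by
          push_cast; exact mul_lt_mul_of_pos_left (hxi j).2 hN'
        have h3 := Int.le_floor.2 h1
        have h4 := Int.floor_lt.2 h2
        push_cast
        constructor <;> linarith
      have hcast : ∀ j, (((⌊N * x j⌋ - N * (i j - 3)).toNat : ℕ) : ℤ) =
          ⌊N * x j⌋ - N * (i j - 3) := fun j => Int.toNat_of_nonneg (hfloor j).1
      refine volume_mul_enorm_sq_le hN
        (hmean fun j => ⟨(⌊N * x j⌋ - N * (i j - 3)).toNat, by
          exact_mod_cast (hcast j).trans_lt (hfloor j).2⟩) fun j => ?_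
      have h5 : (N * (i j - 3) + ((⌊N * x j⌋ - N * (i j - 3)).toNat : ℕ) : ℤ) = ⌊N * x j⌋ := by
        rw [hcast]; ring
      simp only [h5]
      exact ⟨Int.floor_le _, Int.lt_floor_add_one _⟩
    · rw [Set.indicator_of_notMem hxi]
      simp
  have hcut : ‖cutoff n i f‖ₑ ^ 2 = ∫⁻ x, ‖(siteCube i).indicator f x‖ₑ ^ 2 := by
    rw [← lintegral_enorm_sq]
    refine lintegral_congr_ae ?_
    filter_upwards [scalarOp_apply_ae (memLp_siteCube i) f] with x hx
    rw [cutoff, hx]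
    by_cases hxi : x ∈ siteCube i
    · simp [Set.indicator_of_mem hxi]
    · simp [Set.indicator_of_notMem hxi]
  have htrl : ∀ h ∈ differenceCube d N, ∫⁻ x, ‖f (x + h) - f x‖ₑ ^ 2 ≤
      ENNReal.ofReal (K * (d / N)) ^ 2 := fun h hh => by
    have e : ∫⁻ x, ‖f (x + h) - f x‖ₑ ^ 2 = ‖translation n h f - f‖ₑ ^ 2 := by
      rw [← lintegral_enorm_sq]
      refine lintegral_congr_ae ?_
      filter_upwards [translation_apply_ae h f, Lp.coeFn_sub (translation n h f) f] with x e1 e2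
      rw [e2, Pi.sub_apply, e1]
    rw [e, ← ofReal_norm]
    gcongr
    exact (htr h).trans (by gcongr; exact norm_le_of_mem_differenceCube hN hh)
  have hmain : v * ‖cutoff n i f‖ₑ ^ 2 ≤ v * (2 ^ d * ENNReal.ofReal (K * (d / N)) ^ 2) := by
    calc v * ‖cutoff n i f‖ₑ ^ 2 = ∫⁻ x, v * ‖(siteCube i).indicator f x‖ₑ ^ 2 := by
          rw [hcut, lintegral_const_mul' _ _ hvt]
      _ ≤ ∫⁻ x, ∫⁻ h in differenceCube d N, ‖f (x + h) - f x‖ₑ ^ 2 := lintegral_mono hx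
      _ = ∫⁻ h in differenceCube d N, ∫⁻ x, ‖f (x + h) - f x‖ₑ ^ 2 := by
          refine lintegral_lintegral_swap (Measurable.aemeasurable ?_)
          have h1 : Measurable fun p : Space d × Space d => f (p.1 + p.2) :=
            hfm.comp (measurable_fst.add measurable_snd)
          exact ((h1.sub (hfm.comp measurable_fst)).enorm).pow_const 2
      _ ≤ ∫⁻ _h in differenceCube d N, ENNReal.ofReal (K * (d / N)) ^ 2 :=
          setLIntegral_mono' (measurableSet_differenceCube hN) htrl
      _ = _ := by
          rw [setLIntegral_const, volume_differenceCube hN]; ring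
  have h2 : ‖cutoff n i f‖ₑ ^ 2 ≤ ENNReal.ofReal (2 ^ d * d * K / N) ^ 2 := by
    refine ((ENNReal.mul_le_mul_iff_right hv0 hvt).1 hmain).trans ?_
    have h3 : (2 : ℝ≥0∞) ^ d ≤ (2 ^ d) ^ 2 := le_self_pow₀ (one_le_pow₀ one_le_two) two_ne_zero
    calc _ ≤ ((2 : ℝ≥0∞) ^ d) ^ 2 * ENNReal.ofReal (K * (d / N)) ^ 2 := by gcongr
      _ = _ := by
        rw [← mul_pow]
        congr 1
        rw [show (2 : ℝ≥0∞) ^ d = ENNReal.ofReal (2 ^ d) by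
          rw [ENNReal.ofReal_pow (by norm_num)]; simp, ← ENNReal.ofReal_mul (by positivity)]
        congr 1
        ring
  have h3 := (ENNReal.pow_le_pow_left_iff two_ne_zero).1 h2
  rwa [← ofReal_norm, ENNReal.ofReal_le_ofReal_iff (by positivity)] at h3

/-! ### Gelfand numbers of the cut-off resolvent -/

theorem IsGelfandBound.of_fintype {H : Type*} [NormedAddCommGroup H] [InnerProductSpace ℂ H]
    {T : H →L[ℂ] H} {ι : Type*} [Fintype ι] (s : ι → H) {ε : ℝ}
    (h : ∀ f, (∀ i, inner ℂ (s i) f = 0) → ‖T f‖ ≤ ε * ‖f‖) :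
    IsGelfandBound T (Fintype.card ι) ε :=
  ⟨fun k => s ((Fintype.equivFin ι).symm k), fun f hf => h f fun i => by
    simpa using hf (Fintype.equivFin ι i)⟩

theorem mul_norm_le_norm_mulOp {S : LinftyMat d n} {a : ℝ}
    (hS : ∀ᵐ x, (S x - (a : ℂ) • (1 : Mat n)).PosSemidef) (ψ : L2 d n) :
    a * ‖ψ‖ ≤ ‖mulOp S ψ‖ := by
  rcases le_or_gt a 0 with ha | ha
  · exact (mul_nonpos_of_nonpos_of_nonneg ha (norm_nonneg _)).trans (norm_nonneg _)
  suffices h : ‖ψ‖ ≤ a⁻¹ * ‖mulOp S ψ‖ by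
    rwa [← div_eq_inv_mul, le_div_iff₀' ha] at h
  refine norm_le_of_ae_norm_le ?_
  filter_upwards [hS, mulOp_apply_ae S ψ] with x hx e
  rw [e]
  set v := ψ x
  set w : Spinor n := WithLp.toLp 2 ((S x).mulVec v.ofLp) with hw
  have h1 : 0 ≤ (inner ℂ v (w - (a : ℂ) • v)).re := by
    have h2 := hx.dotProduct_mulVec_nonneg v.ofLp
    have h3 : inner ℂ v (w - (a : ℂ) • v) =
        dotProduct (star v.ofLp) ((S x - (a : ℂ) • (1 : Mat n)).mulVec v.ofLp) := by
      rw [EuclideanSpace.inner_eq_star_dotProduct, dotProduct_comm, Matrix.sub_mulVec,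
        Matrix.smul_mulVec, Matrix.one_mulVec]
      rfl
    rw [h3]
    exact (Complex.nonneg_iff.1 h2).1
  rw [inner_sub_right, inner_smul_right, Complex.sub_re, Complex.re_ofReal_mul,
    inner_self_eq_norm_sq_to_K] at h1
  have h4 : ((((‖v‖ : ℝ) : ℂ)) ^ 2).re = ‖v‖ ^ 2 := by
    rw [← Complex.ofReal_pow, Complex.ofReal_re]
  have h5 : (inner ℂ v w).re ≤ ‖v‖ * ‖w‖ :=
    (Complex.re_le_norm _).trans (norm_inner_le_norm _ _)
  rw [← div_eq_inv_mul, le_div_iff₀' ha]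
  by_cases hv : ‖v‖ = 0
  · rw [hv, mul_zero]; exact norm_nonneg _
  · have hv' : 0 < ‖v‖ := lt_of_le_of_ne (norm_nonneg _) (Ne.symm hv)
    change 0 ≤ (inner ℂ v w).re - a * ((((‖v‖ : ℝ) : ℂ)) ^ 2).re at h1
    rw [h4] at h1
    refine le_of_mul_le_mul_left ?_ hv'
    nlinarith

theorem volume_gridCube_ne_top {N : ℕ} (hN : 0 < N) (k : Fin d → ℤ) :
    volume (gridCube N k) ≠ ⊤ := by
  rw [volume_gridCube hN]
  exact ENNReal.pow_ne_top ENNReal.ofReal_ne_top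

/-- The cut-off resolvent `χᵢ R` has Gelfand numbers of order `m^(-1/d)`: on the functions `f` for
which `S R f` has mean zero on all the cubes of side `1 / N` in `siteCube i`, it is `O(1 / N)`. -/
theorem isGelfandBound_cutoff_mul_resolvent {σ : Fin d → Mat n} {c : ℝ} (hc : 0 < c)
    (hσ : ∀ (p : Space d) (v : Spinor n), c * ‖p‖ * ‖v‖ ≤
      ‖Matrix.toEuclideanCLM (n := Fin n) (𝕜 := ℂ) (∑ j, (p j : ℂ) • σ j) v‖)
    {S V₀ : LinftyMat d n} {a : ℝ} (ha : 0 < a)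
    (hS : ∀ᵐ x, (S x - (a : ℂ) • (1 : Mat n)).PosSemidef) {z : ℂ}
    {R : L2 d n →L[ℂ] L2 d n} (hR : IsResolventAt (gappedOp σ S V₀) z R) {b e : ℝ}
    (hb : ‖R‖ ≤ b) (he : ‖z‖ ≤ e) {N : ℕ} (hN : 0 < N) (i : Fin d → ℤ) :
    IsGelfandBound (cutoff n i * R) ((6 * N) ^ d * n)
      (a⁻¹ * (2 ^ d * d * (c⁻¹ * (a⁻¹ * (1 + ‖mulOp V₀‖ * b + e * b)))) / N) := by
  have hb0 : 0 ≤ b := (norm_nonneg _).trans hb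
  have he0 : 0 ≤ e := (norm_nonneg _).trans he
  let cube : (Fin d → Fin (6 * N)) → Set (Space d) := fun m =>
    gridCube N fun j => N * (i j - 3) + (m j : ℕ)
  have hcard : Fintype.card ((Fin d → Fin (6 * N)) × Fin n) = (6 * N) ^ d * n := by simp
  rw [← hcard]
  refine IsGelfandBound.of_fintype (fun p => ContinuousLinearMap.adjoint (mulOp S * R)
    (indicatorConstLp 2 (measurableSet_gridCube hN _ : MeasurableSet (cube p.1))
      (volume_gridCube_ne_top hN _) (EuclideanSpace.single p.2 (1 : ℂ)))) fun f hf => ?_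
  set ψ := R f with hψ
  set φ := mulOp S ψ with hφ
  have hψf : ‖ψ‖ ≤ b * ‖f‖ := R.le_of_opNorm_le hb f
  obtain ⟨g, hg, hgf⟩ := (hR.apply_eq_iff f ψ).1 rfl
  have hD : ‖diracOp σ g‖ ≤ a⁻¹ * (1 + ‖mulOp V₀‖ * b + e * b) * ‖f‖ := by
    have h1 := mul_norm_le_norm_mulOp hS (diracOp σ g)
    have h2 : mulOp S (diracOp σ g) = f - mulOp V₀ ψ + z • ψ := by rw [← hgf]; abel
    rw [mul_assoc, ← div_eq_inv_mul, le_div_iff₀' ha]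
    refine h1.trans ?_
    rw [h2]
    calc _ ≤ ‖f‖ + ‖mulOp V₀ ψ‖ + ‖z • ψ‖ :=
          (norm_add_le _ _).trans (by gcongr; exact norm_sub_le _ _)
      _ ≤ ‖f‖ + ‖mulOp V₀‖ * (b * ‖f‖) + e * (b * ‖f‖) := by
          rw [norm_smul]
          gcongr
          exact ((mulOp V₀).le_opNorm ψ).trans (by gcongr)
      _ = _ := by ring
  have hmean : ∀ m, ∫ y in cube m, φ y = 0 := fun m => by
    ext l
    have h := hf (m, l)
    rw [ContinuousLinearMap.adjoint_inner_left] at h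
    change inner ℂ _ φ = 0 at h
    rw [L2.inner_indicatorConstLp_eq_inner_setIntegral, EuclideanSpace.inner_single_left] at h
    simpa using h
  have hcut : ‖cutoff n i φ‖ ≤
      2 ^ d * d * (c⁻¹ * (a⁻¹ * (1 + ‖mulOp V₀‖ * b + e * b) * ‖f‖)) / N := by
    refine norm_cutoff_le hN (by positivity) (fun h => ?_) hmean
    refine (norm_translation_sub_le hc hσ hg h).trans ?_
    calc _ ≤ c⁻¹ * ‖h‖ * (a⁻¹ * (1 + ‖mulOp V₀‖ * b + e * b) * ‖f‖) := by gcongr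
      _ = _ := by ring
  have h3 := mul_norm_le_norm_mulOp hS (cutoff n i ψ)
  rw [cutoff, mulOp_scalarOp] at h3
  calc ‖cutoff n i ψ‖ ≤ a⁻¹ * ‖cutoff n i φ‖ := by
        rw [← div_eq_inv_mul, le_div_iff₀' ha]; exact h3
    _ ≤ a⁻¹ * (2 ^ d * d * (c⁻¹ * (a⁻¹ * (1 + ‖mulOp V₀‖ * b + e * b) * ‖f‖)) / N) := by gcongr
    _ = _ := by ring

/-! ### Single-site potentials -/

theorem exists_norm_translateMulOp_le {u : Space d → Mat n} (hu : MemLp u ∞ volume) :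
    ∃ M : ℝ, 0 ≤ M ∧ ∀ a, ‖translateMulOp u hu a‖ ≤ M := by
  refine ⟨‖ContinuousLinearMap.holderL (volume : Measure (Space d)) ∞ 2 2
    (LinearMap.toContinuousLinearMap
      (Matrix.toEuclideanCLM (n := Fin n) (𝕜 := ℂ)).toAlgEquiv.toLinearMap)‖ *
      (eLpNorm u ∞ volume).toReal, by positivity, fun a => ?_⟩
  refine (ContinuousLinearMap.le_opNorm _ _).trans_eq ?_
  rw [Lp.norm_toLp, eLpNorm_comp_measurePreserving hu.1
    (measurePreserving_sub_right (volume : Measure (Space d)) a)]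

theorem translateMulOp_apply_ae {u : Space d → Mat n} (hu : MemLp u ∞ volume) (a : Space d)
    (ψ : L2 d n) : translateMulOp u hu a ψ =ᵐ[volume]
      fun x => WithLp.toLp 2 ((u (x - a)).mulVec (ψ x).ofLp) := by
  have h := hu.comp_measurePreserving (measurePreserving_sub_right volume a)
  filter_upwards [mulOp_apply_ae (h.toLp (u ∘ fun x => x - a)) ψ, h.coeFn_toLp] with x h1 h2
  rw [translateMulOp, h1, h2]
  rfl

theorem eq_zero_of_notMem_siteCube {u : Space d → Mat n}
    (hu_supp : tsupport u ⊆ {x | ∀ j, |x j| ≤ 2}) {r : ℝ} (hr : r < 1 / 2) {k : Fin d → ℤ}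
    {ξ : Space d} (hξ : ∀ j, |ξ j| ≤ r) {x : Space d} (hx : x ∉ siteCube k) :
    u (x - (latticePoint k + ξ)) = 0 := by
  by_contra h0
  refine hx fun j => ?_
  have h1 := hu_supp (subset_tsupport u h0) j
  have h2 : (x - (latticePoint k + ξ)) j = x j - (k j + ξ j) := rfl
  rw [h2] at h1
  have h3 := abs_le.1 h1
  have h4 := abs_le.1 (hξ j)
  constructor <;> linarith [h3.1, h3.2, h4.1, h4.2]

theorem cutoff_mul_translateMulOp {u : Space d → Mat n} (hu : MemLp u ∞ volume)
    (hu_supp : tsupport u ⊆ {x | ∀ j, |x j| ≤ 2}) {r : ℝ} (hr : r < 1 / 2) (k : Fin d → ℤ)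
    {ξ : Space d} (hξ : ∀ j, |ξ j| ≤ r) :
    cutoff n k * translateMulOp u hu (latticePoint k + ξ) =
      translateMulOp u hu (latticePoint k + ξ) := by
  ext1 ψ
  refine Lp.ext ?_
  filter_upwards [translateMulOp_apply_ae hu (latticePoint k + ξ) ψ,
    scalarOp_apply_ae (memLp_siteCube k) (translateMulOp u hu (latticePoint k + ξ) ψ)] with x h1 h2
  rw [mul_apply_eq_comp, cutoff, h2, h1]
  by_cases hx : x ∈ siteCube k
  · simp [Set.indicator_of_mem hx]
  · simp [Set.indicator_of_notMem hx, eq_zero_of_notMem_siteCube hu_supp hr hξ hx]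

theorem translateMulOp_mul_cutoff {u : Space d → Mat n} (hu : MemLp u ∞ volume)
    (hu_supp : tsupport u ⊆ {x | ∀ j, |x j| ≤ 2}) {r : ℝ} (hr : r < 1 / 2) (k : Fin d → ℤ)
    {ξ : Space d} (hξ : ∀ j, |ξ j| ≤ r) :
    translateMulOp u hu (latticePoint k + ξ) * cutoff n k =
      translateMulOp u hu (latticePoint k + ξ) := by
  rw [← cutoff_mul_translateMulOp hu hu_supp hr k hξ]
  nth_rw 2 [← cutoff_mul_translateMulOp hu hu_supp hr k hξ]
  ext1 ψ
  simp only [mul_apply_eq_comp, cutoff, translateMulOp]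
  rw [mulOp_scalarOp]

/-! ### Products of single-site potentials and resolvents -/

section Product

variable {H : Type*} [NormedAddCommGroup H] [InnerProductSpace ℂ H] {p : ℕ} {R : H →L[ℂ] H}
  {U χ : Fin (p + 1) → H →L[ℂ] H} {M : ℝ}

theorem norm_resolventProduct_le (hM : 0 ≤ M) (hU : ∀ k, ‖U k‖ ≤ M) (hl : ∀ k, χ k * U k = U k)
    (hr : ∀ k, U k * χ k = U k) {c : Fin p → ℝ}
    (hc : ∀ k : Fin p, ∀ m, m = 1 ∨ m = 2 → ‖χ k.castSucc * R ^ m * χ k.succ‖ ≤ c k) :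
    ‖resolventProduct R U‖ ≤ M ^ (p + 1) * ∏ k, c k := by
  refine norm_prod_ofFn_le hM U _ χ c hU hl hr (fun k => hc k _ ?_) ?_
  · have := k.2
    rw [Fin.val_castSucc, if_neg (by lia)]
    split_ifs <;> simp
  · rw [Fin.val_last, if_pos rfl, pow_zero]

/-- Each of the `p` factors `U k * R` or `U k * R ^ 2` is localised by a cutoff, as
`U k * R = U k * (χ k * R)`, and contributes one factor `ε`. -/
theorem isGelfandBound_resolventProduct [CompleteSpace H] (hM : 0 ≤ M) (hU : ∀ k, ‖U k‖ ≤ M)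
    (hr : ∀ k, U k * χ k = U k) {b ε : ℝ} {m : ℕ} (hb : 1 ≤ b) (hR : ‖R‖ ≤ b) (hε : 0 ≤ ε)
    (hg : ∀ k, IsGelfandBound (χ k * R) m ε) :
    IsGelfandBound (resolventProduct R U) (p * m) ((M * ε * b) ^ p * M) := by
  refine IsGelfandBound.prod_ofFn (by positivity) _ (fun k => ?_) ?_
  · have hk := k.2
    have key : ∀ T : H →L[ℂ] H, ‖T‖ ≤ b →
        IsGelfandBound (U k.castSucc * (R * T)) m (M * ε * b) := fun T hT => by
      have h1 := (((isGelfandBound_of_norm_le (hU k.castSucc)).mul hM (hg k.castSucc)).mul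
        (by positivity) (isGelfandBound_of_norm_le hT))
      rwa [zero_add, add_zero, ← mul_assoc, hr, mul_assoc] at h1
    rw [Fin.val_castSucc, if_neg (by lia)]
    split_ifs
    · rw [sq]; exact key R hR
    · have := key 1 (ContinuousLinearMap.norm_id_le.trans hb)
      rwa [mul_one, ← pow_one R] at this
  · rw [Fin.val_last, if_pos rfl, pow_zero, mul_one]
    exact hU _

end Product

/-! ### Uniform bounds on a compact set of energies -/

/-- The summable kernel `(1 + δ² |i - k|²)^(-d)` on the lattice. -/
noncomputable def latticeKernel (δ : ℝ) (i k : Fin d → ℤ) : ℝ :=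
  ((1 + ‖δ • (latticePoint i - latticePoint k)‖ ^ 2) ^ d)⁻¹

theorem latticeKernel_nonneg (δ : ℝ) (i k : Fin d → ℤ) : 0 ≤ latticeKernel δ i k := by
  rw [latticeKernel]; positivity

theorem latticeKernel_le_one (δ : ℝ) (i k : Fin d → ℤ) : latticeKernel δ i k ≤ 1 :=
  inv_le_one_of_one_le₀ (one_le_pow₀
    (by nlinarith [sq_nonneg ‖δ • (latticePoint i - latticePoint k)‖]))

/-- The decay rate and the constant depend on the resolvent only through a bound on its norm. -/
theorem exists_norm_cutoff_resolvent_cutoff_le (σ : Fin d → Mat n) (S V₀ : LinftyMat d n)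
    {b : ℝ} (hb : 0 ≤ b) : ∃ δ C : ℝ, 0 < δ ∧ 1 ≤ C ∧ ∀ (z : ℂ) (R : L2 d n →L[ℂ] L2 d n),
      IsResolventAt (gappedOp σ S V₀) z R → ‖R‖ ≤ b → ∀ m, m = 1 ∨ m = 2 → ∀ i k,
        ‖cutoff n i * R ^ m * cutoff n k‖ ≤ C * latticeKernel δ i k ^ 4 := by
  set A := ‖mulOp S‖ * ((∑ j, ‖constMulOp d (σ j)‖) * ‖mulOp S‖) with hA
  have hA0 : 0 ≤ A := by positivity
  -- the weight has exponent `4 d`: its fourth root is `latticeKernel`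
  set s := 4 * d with hs
  set δ : ℝ := (2 * (b * A * s + 1))⁻¹ with hδ
  have hδ0 : 0 < δ := by positivity
  have hsmall : b * (‖mulOp S‖ * ((∑ j, ‖constMulOp d (σ j)‖) * (s * δ) * ‖mulOp S‖)) ≤ 1 / 2 := by
    have h1 : b * (‖mulOp S‖ * ((∑ j, ‖constMulOp d (σ j)‖) * (s * δ) * ‖mulOp S‖)) =
        b * A * s / (2 * (b * A * s + 1)) := by
      rw [hδ, div_eq_mul_inv]
      simp only [hA]
      ring
    rw [h1, div_le_div_iff₀ (by positivity) (by norm_num)]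
    linarith
  set B : ℝ := (1 + 2 * b) ^ 2 with hB
  refine ⟨δ, max ((2 * (1 + δ ^ 2 * (9 * d)) ^ 2) ^ s * B) 1, hδ0, le_max_right _ _,
    fun z R hR hRb m hm i k => ?_⟩
  have hW : ∀ y f, ‖scalarOp n _ (memLp_decayWeight δ s y) ((R ^ m) f)‖ ≤
      B * ‖scalarOp n _ (memLp_decayWeight δ s y) f‖ := by
    intro y f
    have h1 := norm_decayWeight_resolvent_le hR hRb hδ0.le hsmall y
    rcases hm with rfl | rfl
    · rw [pow_one]
      refine (h1 f).trans ?_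
      gcongr
      rw [hB]; nlinarith
    · calc _ ≤ 2 * b * ‖scalarOp n _ (memLp_decayWeight δ s y) (R f)‖ := h1 (R f)
        _ ≤ 2 * b * (2 * b * ‖scalarOp n _ (memLp_decayWeight δ s y) f‖) := by
            gcongr; exact h1 f
        _ = (2 * b * (2 * b)) * ‖scalarOp n _ (memLp_decayWeight δ s y) f‖ := by ring
        _ ≤ _ := by
            gcongr
            rw [hB]; nlinarith
  have h4 : decayWeight δ s (latticePoint k) (latticePoint i) = latticeKernel δ i k ^ 4 := by
    rw [decayWeight, latticeKernel, hs, inv_pow, ← pow_mul, mul_comm d 4]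
  rw [← h4]
  refine (norm_cutoff_mul_mul_cutoff_le (by positivity) hW i k).trans ?_
  gcongr
  · exact (decayWeight_pos _ _ _ _).le
  · exact le_max_left _ _

/-- The trace norm of a product of single-site potentials and resolvents decays in the distances
between consecutive sites. With `p ≥ 2 d` resolvents, the Gelfand numbers of the product decay like
`m^(-p/d)`, hence at least like `m⁻²`, and the decay of the operator norm is inherited up to a
fourth root. -/
theorem exists_traceNorm_resolventProduct_le (d n : ℕ) (hd : 1 ≤ d) (hn : 1 ≤ n) {p : ℕ}
    (hp : 2 * d ≤ p) {M C G b : ℝ} (hM : 1 ≤ M) (hC : 1 ≤ C) (hG : 0 ≤ G) (hb : 1 ≤ b) :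
    ∃ C' : ℝ, 0 < C' ∧ ∀ (δ : ℝ) (R : L2 d n →L[ℂ] L2 d n) (i : Fin (p + 1) → Fin d → ℤ)
      (U : Fin (p + 1) → L2 d n →L[ℂ] L2 d n), ‖R‖ ≤ b → (∀ k, ‖U k‖ ≤ M) →
      (∀ k, cutoff n (i k) * U k = U k) → (∀ k, U k * cutoff n (i k) = U k) →
      (∀ m, m = 1 ∨ m = 2 → ∀ i k,
        ‖cutoff n i * R ^ m * cutoff n k‖ ≤ C * latticeKernel δ i k ^ 4) →
      (∀ N : ℕ, 0 < N → ∀ i, IsGelfandBound (cutoff n i * R) ((6 * N) ^ d * n) (G / N)) →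
      traceNorm (resolventProduct R U) ≤ ENNReal.ofReal C' *
        ∏ k : Fin p, ENNReal.ofReal (latticeKernel δ (i k.castSucc) (i k.succ)) := by
  have hM0 : 0 ≤ M := zero_le_one.trans hM
  have hb0 : 0 ≤ b := zero_le_one.trans hb
  set Γ : ℝ := M ^ (p + 1) * C ^ p with hΓ
  have hΓ1 : 1 ≤ Γ := one_le_mul_of_one_le_of_one_le (one_le_pow₀ hM) (one_le_pow₀ hC)
  have hΓ0 : 0 < Γ := zero_lt_one.trans_le hΓ1
  set Cg : ℝ := (M * G * b) ^ p * M + Γ ^ 4 with hCg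
  have hD : 0 < p * (6 ^ d * n) := by
    have : 0 < p := by lia
    positivity
  obtain ⟨C', hC'0, hC'⟩ := exists_traceNorm_le_of_isGelfandBound (L2 d n) hD
    (B := 2 ^ d) (Nat.le_self_pow (by lia) 2) (C := Cg) (by positivity)
  refine ⟨C' * Γ, by positivity, fun δ R i U hR hU hl hr hdecay hgel => ?_⟩
  set P : ℝ := ∏ k : Fin p, latticeKernel δ (i k.castSucc) (i k.succ) with hP
  have hP0 : 0 ≤ P := Finset.prod_nonneg fun k _ => latticeKernel_nonneg _ _ _
  have hP1 : P ≤ 1 :=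
    Finset.prod_le_one (fun k _ => latticeKernel_nonneg _ _ _) fun k _ => latticeKernel_le_one _ _ _
  set K := resolventProduct R U with hK
  have hKn : ‖K‖ ≤ (Γ * P) ^ 4 := by
    calc ‖K‖ ≤ M ^ (p + 1) * ∏ k : Fin p, (C * latticeKernel δ (i k.castSucc) (i k.succ) ^ 4) :=
          norm_resolventProduct_le (χ := fun k => cutoff n (i k)) hM0 hU hl hr
            (fun k m hm => hdecay m hm _ _)
      _ = Γ * P ^ 4 := by
          rw [Finset.prod_mul_distrib, Finset.prod_pow, Finset.prod_const, Finset.card_fin, hΓ,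
            ← hP, mul_assoc]
      _ ≤ Γ ^ 4 * P ^ 4 := by
          gcongr
          exact le_self_pow₀ hΓ1 (by norm_num)
      _ = _ := by ring
  have hKC : ‖K‖ ≤ Cg := by
    refine hKn.trans ?_
    rw [mul_pow, hCg]
    have h1 : Γ ^ 4 * P ^ 4 ≤ Γ ^ 4 :=
      mul_le_of_le_one_right (by positivity) (pow_le_one₀ hP0 hP1)
    have h2 : 0 ≤ (M * G * b) ^ p * M := by positivity
    linarith
  have hKg : ∀ k : ℕ, IsGelfandBound K (p * (6 ^ d * n) * (2 ^ d) ^ k)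
      (Cg / (((2 ^ d : ℕ) : ℝ) ^ k) ^ 2) := fun k => by
    -- the cubes have side `2⁻ᵏ`, and their number is a multiple of `(2 ^ d) ^ k`
    have h1 := isGelfandBound_resolventProduct (χ := fun k => cutoff n (i k)) hM0 hU hr hb hR
      (by positivity) (fun l => hgel (2 ^ k) (by positivity) (i l))
    have h2 : p * (6 ^ d * n) * (2 ^ d) ^ k = p * ((6 * 2 ^ k) ^ d * n) := by ring
    rw [h2]
    refine h1.mono ?_
    rw [le_div_iff₀ (by positivity)]
    have h3 : (((2 ^ d : ℕ) : ℝ) ^ k) ^ 2 ≤ ((2 : ℝ) ^ k) ^ p := by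
      push_cast
      rw [← pow_mul, ← pow_mul, ← pow_mul]
      refine pow_le_pow_right₀ one_le_two ?_
      nlinarith
    calc _ ≤ (M * (G / ((2 ^ k : ℕ) : ℝ)) * b) ^ p * M * ((2 : ℝ) ^ k) ^ p := by gcongr
      _ = (M * G * b) ^ p * M := by
          push_cast
          rw [mul_right_comm, ← mul_pow]
          congr 2
          field_simp
      _ ≤ Cg := by rw [hCg]; linarith [pow_nonneg hΓ0.le 4]
  refine (hC' K hKg hKC (Γ * P) (by positivity) hKn).trans_eq ?_
  rw [← mul_assoc, ENNReal.ofReal_mul (by positivity), hP,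
    ENNReal.ofReal_prod_of_nonneg fun k _ => latticeKernel_nonneg _ _ _]

end GappedDirac

open GappedDirac in
theorem proposition4p3 {d n : ℕ} (hd : 1 ≤ d) (hn : 1 ≤ n)
    (σ : Fin d → Mat n) (hσ : ∀ j, (σ j).IsHermitian) (hσ_ell : IsElliptic σ)
    (S V₀ : LinftyMat d n)
    (hS_pos : IsCoefficientPositive S) (hS_W : MemW1Infty S) (hS_per : IsLatticePeriodic S)
    (hV_herm : ∀ᵐ x, (V₀ x).IsHermitian) (hV_per : IsLatticePeriodic V₀)
    (Bm Bp : ℝ) (hB : Bm < Bp)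
    (hgap : ∀ E ∈ Set.Ioo Bm Bp, (E : ℂ) ∉ unboundedSpectrum (gappedOp σ S V₀))
    (u : Space d → Mat n) (hu : MemLp u ∞ volume) (hu_pos : ∀ᵐ x, (u x).PosSemidef)
    (hu_cont : ∀ᵐ x, ContinuousAt u x) (hu_supp : tsupport u ⊆ {x | ∀ j, |x j| ≤ 2})
    (r : ℝ) (hr_pos : 0 < r) (hr_lt : r < 1 / 2)
    (I : Set ℝ) (hI : IsCompact I) (hI_gap : I ⊆ Set.Ioo Bm Bp)
    (q : ℕ) (hq_even : Even q) (hq : 2 * d < q) :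
    ∃ C : ℝ≥0, 0 < C ∧ ∀ E₀ ∈ I, ∀ (x : Fin d → ℤ) (L : ℕ), Even L →
      ∀ ξ : (Fin d → ℤ) → Space d, (∀ i j, |ξ i j| ≤ r) →
        ∑' i : Fin q → latticeBox x L,
          traceNorm (resolventProduct (unboundedResolvent (gappedOp σ S V₀) (E₀ : ℂ))
            fun k => translateMulOp u hu (latticePoint (i k : Fin d → ℤ) + ξ (i k))) ≤
          C * volume (box x L) := by
  obtain ⟨c, hc, hell⟩ := hσ_ell
  obtain ⟨a, a', ha, ha', hab⟩ := hS_pos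
  have hSa : ∀ᵐ x, (S x - (a : ℂ) • (1 : Mat n)).PosSemidef := hab.mono fun x h => h.1
  have hres : ∀ E ∈ I, (E : ℂ) ∈ unboundedResolventSet (gappedOp σ S V₀) := fun E hE =>
    not_not.1 (hgap E (hI_gap hE))
  obtain ⟨b, hb, hRb⟩ := exists_norm_resolvent_le hI hres
  obtain ⟨e, he⟩ := hI.isBounded.exists_norm_le
  obtain ⟨M₀, hM₀, hUM₀⟩ := exists_norm_translateMulOp_le hu
  obtain ⟨p, rfl⟩ : ∃ p, q = p + 1 := ⟨q - 1, by omega⟩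
  obtain ⟨δ, Cw, hδ, hCw, hdecay⟩ := exists_norm_cutoff_resolvent_cutoff_le σ S V₀ hb.le
  obtain ⟨A, hA⟩ := exists_tsum_lattice_le (d := d) hδ
  have he0 : 0 ≤ max e 0 := le_max_right _ _
  obtain ⟨C', hC'0, hC'⟩ := exists_traceNorm_resolventProduct_le d n hd hn (p := p) (by omega)
    (M := max M₀ 1) (C := Cw) (b := max b 1)
    (G := a⁻¹ * (2 ^ d * d * (c⁻¹ * (a⁻¹ * (1 + ‖mulOp V₀‖ * b + max e 0 * b)))))
    (le_max_right _ _) hCw (by positivity) (le_max_right _ _)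
  refine ⟨C'.toNNReal * A ^ p + 1, by positivity, fun E hE x L hL ξ hξ => ?_⟩
  have hR := isResolventAt_unboundedResolvent (hres E hE)
  have hterm : ∀ i : Fin (p + 1) → latticeBox x L,
      traceNorm (resolventProduct (unboundedResolvent (gappedOp σ S V₀) (E : ℂ)) fun k =>
        translateMulOp u hu (latticePoint (i k : Fin d → ℤ) + ξ (i k))) ≤
      ENNReal.ofReal C' *
        ∏ k : Fin p, ENNReal.ofReal
          (latticeKernel δ (i k.castSucc : Fin d → ℤ) (i k.succ : Fin d → ℤ)) := fun i => by
    have h := hC' δ (unboundedResolvent (gappedOp σ S V₀) (E : ℂ))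
      (fun k => (i k : Fin d → ℤ))
      (fun k => translateMulOp u hu (latticePoint (i k : Fin d → ℤ) + ξ (i k)))
      ((hRb E hE).trans (le_max_left _ _))
      (fun k => (hUM₀ _).trans (le_max_left _ _))
      (fun k => cutoff_mul_translateMulOp hu hu_supp hr_lt _ (hξ _))
      (fun k => translateMulOp_mul_cutoff hu hu_supp hr_lt _ (hξ _))
      (hdecay _ _ hR (hRb E hE))
      (fun N hN k => isGelfandBound_cutoff_mul_resolvent hc hell ha hSa hR (hRb E hE)
        (by rw [Complex.norm_real]; exact (he E hE).trans (le_max_left _ _)) hN k)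
    exact h
  calc _ ≤ ∑' i : Fin (p + 1) → latticeBox x L, ENNReal.ofReal C' *
        ∏ k : Fin p, ENNReal.ofReal
          (latticeKernel δ (i k.castSucc : Fin d → ℤ) (i k.succ : Fin d → ℤ)) :=
        ENNReal.tsum_le_tsum hterm
    _ ≤ ENNReal.ofReal C' * ((∑' _ : latticeBox x L, 1) * (A : ℝ≥0∞) ^ p) := by
        rw [ENNReal.tsum_mul_left]
        gcongr
        refine tsum_prod_chain_le
          (fun i k : latticeBox x L =>
            ENNReal.ofReal (latticeKernel δ (i : Fin d → ℤ) (k : Fin d → ℤ))) A (fun k => ?_) p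
        exact (ENNReal.tsum_comp_le_tsum_of_injective Subtype.val_injective
          (fun j : Fin d → ℤ => ENNReal.ofReal (latticeKernel δ j (k : Fin d → ℤ)))).trans (hA k)
    _ ≤ ENNReal.ofReal C' * (volume (box x L) * (A : ℝ≥0∞) ^ p) := by
        gcongr
        exact tsum_latticeBox_le x hL
    _ = ((C'.toNNReal * A ^ p : ℝ≥0) : ℝ≥0∞) * volume (box x L) := by
        rw [ENNReal.ofReal]
        push_cast
        ring
    _ ≤ _ := by
        gcongr
        exact le_self_add
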